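/- Let $N>1$, $a\ge 1$, $b\ge 1$ be integers and let $\alpha\in[1/2,1]$. Consider $N$ urns on a probability space $(\Omega,\mathcal A,P)$, each containing $a$ red and $b$ black balls at time $0$. At each time $t+1$ ($t\ge 0$) one ball is added to each urn. Let $Z_t(i)$ be the fraction of red balls in urn $i$ at time $t$, let $Z_t=\frac1N\sum_{i=1}^N Z_t(i)$, and let $\mathcal F_t$ be the $\sigma$-field generated by the colours of the balls added at times $1,\dots,t$. Conditionally on $\mathcal F_t$, the balls added at time $t+1$ to the different urns have independent colours, and the one added to urn $i$ is red with probability $\alpha Z_t+(1-\alpha)Z_t(i)$ and black otherwise. Then $Z_t$ converges almost surely to a random variable $Z$. Moreover, for each fixed urn $j$, as $t\to\infty$: (i) if $1/2<\alpha\le 1$, then $$\sqrt t\,\bigl(Z_t(j)-Z_t\bigr)\longrightarrow \mathcal N\Bigl(0,\ \frac{1-\frac1N}{2\alpha-1}\,(Z-Z^2)\Bigr)\quad\text{stably};$$ (ii) if $\alpha=1/2$, then $$\frac{\sqrt t}{\sqrt{\ln t}}\,\bigl(Z_t(j)-Z_t\bigr)\longrightarrow \mathcal N\Bigl(0,\ \bigl(1-\tfrac1N\bigr)(Z-Z^2)\Bigr)\quad\text{stably}.$$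 In both cases the limit Gaussian kernel is not degenerate, i.e. it is not almost surely a point mass (equivalently, its random variance is strictly positive with positive probability). Here real random variables $Y_t$ are said to converge stably to a kernel $K=(K(\omega))_{\omega\in\Omega}$ of probability measures on $\mathbb R$ if, for every $H\in\mathcal A$ with $P(H)>0$, the conditional law $P(Y_t\in\cdot\mid H)$ converges weakly to $E[K(\cdot)\mid H]$; $\mathcal N(0,V)$ denotes the kernel $\omega\mapsto\mathcal N(0,V(\omega))$, and $\mathcal N(0,0)$ is the point mass at $0$. -/

import Mathlib

open MeasureTheory ProbabilityTheory Filter Topology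
open scoped BoundedContinuousFunction

noncomputable section

namespace InteractingUrns

/-! ### Kernels and stable convergence -/

section Stable

variable {Ω : Type*} [MeasurableSpace Ω]

/-- Stable convergence of the random variables `Y t` to the kernel `K`: for every event `H` of
positive probability, the conditional law `P(Y t ∈ · | H)` converges weakly to the
measure `E[K(·) | H]`. -/
def ConvergesStably {S : Type*} [TopologicalSpace S] [MeasurableSpace S]
    (P : Measure Ω) (Y : ℕ → Ω → S) (K : Kernel Ω S) [IsMarkovKernel K] : Prop :=
  (∀ t, Measurable (Y t)) ∧
    ∀ H : Set Ω, MeasurableSet H → 0 < P H → ∀ f : S →ᵇ ℝ,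
      Tendsto (fun t : ℕ => ∫ x, f x ∂((P[|H]).map (Y t))) atTop
        (𝓝 (∫ x, f x ∂((P[|H]).bind K)))

/-- The Gaussian kernel `N(0, V)` with random variance `V`; where `V ω = 0` it is the point mass
at `0`. (Negative values of `V`, which only occur on null sets below, are read as `0`.) -/
def gaussianKernel (V : Ω → ℝ) (hV : Measurable V) : Kernel Ω ℝ where
  toFun ω := gaussianReal 0 (V ω).toNNReal
  measurable' :=
    measurable_gaussianReal.comp (measurable_const.prodMk hV.real_toNNReal)

instance (V : Ω → ℝ) (hV : Measurable V) : IsMarkovKernel (gaussianKernel V hV) :=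
  ⟨fun ω => inferInstanceAs (IsProbabilityMeasure (gaussianReal 0 (V ω).toNNReal))⟩

/-- A kernel is degenerate if it is almost surely a point mass. -/
def IsDegenerate (P : Measure Ω) (K : Kernel Ω ℝ) : Prop :=
  ∃ Y : Ω → ℝ, ∀ᵐ ω ∂P, K ω = Measure.dirac (Y ω)

end Stable

/-! ### The urn model

There are `N` urns. For `t ≥ 1`, `red t i` is the event that the ball added to urn `i` at time `t`
is red; the events `red 0 i` play no role. -/

section Model

variable {Ω : Type*} {N : ℕ}

/-- The number of red balls in urn `i` at time `t`, starting from `a` red balls at time `0`. -/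
def redBalls (a : ℕ) (red : ℕ → Fin N → Set Ω) (t : ℕ) (i : Fin N) (ω : Ω) : ℝ :=
  (a : ℝ) + ∑ k ∈ Finset.Icc 1 t, (red k i).indicator (fun _ => (1 : ℝ)) ω

/-- The fraction `Z_t(i)` of red balls in urn `i` at time `t`, when every urn starts from `a` red
and `b` black balls. -/
def urnFraction (a b : ℕ) (red : ℕ → Fin N → Set Ω) (t : ℕ) (i : Fin N) (ω : Ω) : ℝ :=
  redBalls a red t i ω / ((a : ℝ) + b + t)

/-- The total fraction `Z_t` of red balls in the system at time `t`. -/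
def totalFraction (a b : ℕ) (red : ℕ → Fin N → Set Ω) (t : ℕ) (ω : Ω) : ℝ :=
  (1 / (N : ℝ)) * ∑ i, urnFraction a b red t i ω

/-- The σ-field generated by the colours of the balls added at the times `1, …, t`. -/
abbrev history (red : ℕ → Fin N → Set Ω) (t : ℕ) : MeasurableSpace Ω :=
  MeasurableSpace.generateFrom {s | ∃ k i, 1 ≤ k ∧ k ≤ t ∧ s = red k i}

/-- The system of `N` urns with mean-field interaction parameter `α`. Given the history up to
time `t`, the ball added to urn `i` at time `t + 1` is red with conditional probability
`α Z_t + (1 - α) Z_t(i)`, independently for different urns. -/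
structure IsUrnSystem [MeasurableSpace Ω] (P : Measure Ω) (a b : ℕ) (α : ℝ)
    (red : ℕ → Fin N → Set Ω) : Prop where
  measurableSet_red : ∀ t i, MeasurableSet (red (t + 1) i)
  condProb_red : ∀ t i, P⟦red (t + 1) i | history red t⟧ =ᵐ[P]
    fun ω => α * totalFraction a b red t ω + (1 - α) * urnFraction a b red t i ω
  condIndep_red : ∀ t (s : Finset (Fin N)), P⟦⋂ i ∈ s, red (t + 1) i | history red t⟧ =ᵐ[P]
    ∏ i ∈ s, P⟦red (t + 1) i | history red t⟧

end Model

end InteractingUrns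

end

/-! Write `D t` for the fraction in urn `j` minus the total fraction, `m = a + b`, and `n = m + t +
1` for the number of balls per urn after step `t + 1`. The excess of the redness probability of urn
`j` over the total fraction is `(1 - α) D t`, so `D (t+1) = (1 - α/n) D t + noise/n`, with `D 0 = 0`
(`diff_succ`). Hence `D t` is a weighted sum, with deterministic weights, of bounded martingale
differences (`diff_eq_sum`).

The total fraction is a bounded martingale, so it converges to some `Z`. The second moment of `D`
obeys a contracting recursion and tends to 0. All redness probabilities therefore approach `Z` in
L¹, and the conditional variance of the noise tends in L¹ to `(1 - 1/N)(Z - Z²)`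
(`tendsto_integral_abs_noiseVar_sub`).

The probabilistic core is a stable central limit theorem for such sums,
`IsBoundedDifference.convergesStably`, proved with characteristic functions against a bounded test
function. At a late time `s` the conditional variance is almost final, hence may be frozen at its
value at `s`, and the test function may be replaced by its conditional expectation given time `s`.
The terms before `s` have vanishing weights. The later ones are replaced one at a time by Gaussian
factors, which are already known at time `s`.

What remains is the sum of squared weights: it is asymptotic to `1/((2α - 1)t)` when `α > 1/2` and
to `log t / t` when `α = 1/2` (`tendsto_mul_weightSum`, `tendsto_div_log_mul_weightSum`). This fixes
both the scaling and the constant.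

For nondegeneracy, the expectation of `Z_t - Z_t²` loses at most a factor `1 - 1/n²` at each step.
The infinite product of these factors is positive, so the expectation of `Z - Z²` is positive. -/

noncomputable section

namespace InteractingUrns

/-! ### Linear recursions with harmonic contraction -/

section Deterministic

/-- A nonnegative sequence contracted by `1 - a t` with `∑ a t = ∞`, up to errors `o(a t)`, tends
to zero. -/
theorem tendsto_zero_of_contraction {y a e : ℕ → ℝ} (hy : ∀ t, 0 ≤ y t)
    (ha : ∀ᶠ t in atTop, 0 ≤ a t ∧ a t ≤ 1) (hsum : ¬ Summable a)
    (he : Tendsto e atTop (𝓝 0))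
    (h : ∀ᶠ t in atTop, y (t + 1) ≤ (1 - a t) * y t + a t * e t) :
    Tendsto y atTop (𝓝 0) := by
  rw [Metric.tendsto_atTop']
  intro ε hε
  have he' : ∀ᶠ t in atTop, e t ≤ ε / 2 := he.eventually_le_const (by positivity)
  obtain ⟨s, hs⟩ := eventually_atTop.1 (ha.and (he'.and h))
  -- Once errors are below `ε/2`, the excess over `ε/2` contracts by `1 - a t ≤ exp (-a t)`, and the
  -- divergent sum drives the product to 0.
  have key : ∀ k, y (s + k) - ε / 2 ≤
      y s * Real.exp (-∑ i ∈ Finset.range k, a (i + s)) := by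
    intro k
    induction k with
    | zero => simp; linarith
    | succ k ih =>
      obtain ⟨⟨h0, h1⟩, h2, h3⟩ := hs (s + k) (by lia)
      rw [Finset.sum_range_succ, neg_add, Real.exp_add, add_comm k s, ← add_assoc]
      have h4 : 1 - a (s + k) ≤ Real.exp (-a (s + k)) := by
        have := Real.add_one_le_exp (-a (s + k)); linarith
      have h5 := mul_le_mul_of_nonneg_left ih (sub_nonneg.2 h1)
      have h6 := mul_le_mul_of_nonneg_left h4 (mul_nonneg (hy s)
        (Real.exp_nonneg (-∑ i ∈ Finset.range k, a (i + s))))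
      have h7 := mul_le_mul_of_nonneg_left h2 h0
      nlinarith
  have hsum' : ¬ Summable fun i => a (i + s) := by rwa [summable_nat_add_iff s]
  have hdiv := (not_summable_iff_tendsto_nat_atTop_of_nonneg
    (fun i => (hs (i + s) (by lia)).1.1)).1 hsum'
  have hlim : Tendsto (fun k => y s * Real.exp (-∑ i ∈ Finset.range k, a (i + s))) atTop
      (𝓝 (y s * 0)) :=
    (Real.tendsto_exp_neg_atTop_nhds_zero.comp hdiv).const_mul _
  rw [mul_zero] at hlim
  obtain ⟨k₀, hk₀⟩ := eventually_atTop.1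
    (hlim.eventually_lt_const (show (0 : ℝ) < ε / 2 by positivity))
  refine ⟨s + k₀, fun t ht => ?_⟩
  obtain ⟨k, rfl⟩ : ∃ k, t = s + k := ⟨t - s, by lia⟩
  rw [Real.dist_eq, sub_zero, abs_of_nonneg (hy _)]
  have := key k
  have := hk₀ k (by lia)
  linarith

theorem tendsto_natCast_add_atTop (m : ℕ) :
    Tendsto (fun t : ℕ => (m : ℝ) + t + 1) atTop atTop :=
  tendsto_atTop_add_const_right _ _
    (tendsto_atTop_add_const_left _ _ tendsto_natCast_atTop_atTop)

/-- The harmonic series diverges, and `C/n² = (β/n) · (C/(βn))` is an error negligible against the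
contraction rate `β/n`. -/
theorem tendsto_zero_of_harmonic_contraction {y : ℕ → ℝ} (m : ℕ) {β C : ℝ} (hβ : 0 < β)
    (hy : ∀ t, 0 ≤ y t)
    (h : ∀ᶠ t : ℕ in atTop,
      y (t + 1) ≤ (1 - β / ((m : ℝ) + t + 1)) * y t + C / ((m : ℝ) + t + 1) ^ 2) :
    Tendsto y atTop (𝓝 0) := by
  have hn := tendsto_natCast_add_atTop m
  refine tendsto_zero_of_contraction (a := fun t => β / ((m : ℝ) + t + 1))
    (e := fun t => C / β / ((m : ℝ) + t + 1)) hy ?_ ?_ (hn.const_div_atTop _) ?_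
  · filter_upwards [hn.eventually_ge_atTop β] with t ht
    have : 0 < (m : ℝ) + t + 1 := by positivity
    exact ⟨by positivity, (div_le_one this).2 ht⟩
  · intro hs
    have h1 : Summable fun t : ℕ => (((t + (m + 1) : ℕ) : ℝ))⁻¹ := by
      refine (hs.mul_left β⁻¹).congr fun t => ?_
      push_cast
      field_simp
      ring
    exact Real.not_summable_natCast_inv ((summable_nat_add_iff (m + 1)).1 h1)
  · filter_upwards [h] with t ht
    refine ht.trans (le_of_eq ?_)
    have : 0 < (m : ℝ) + t + 1 := by positivity
    field_simp

/-! ### Asymptotics of the weights and of the sum of their squares. -/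

/-- The product of the contraction factors of the recursion from time `k` to time `t`. -/
def contraction (m : ℕ) (α : ℝ) (k t : ℕ) : ℝ :=
  ∏ i ∈ Finset.Ico k t, (1 - α / ((m : ℝ) + i + 1))

@[simp] theorem contraction_self (m : ℕ) (α : ℝ) (k : ℕ) : contraction m α k k = 1 := by
  simp [contraction]

theorem contraction_succ (m : ℕ) (α : ℝ) {k t : ℕ} (h : k ≤ t) :
    contraction m α k (t + 1) = contraction m α k t * (1 - α / ((m : ℝ) + t + 1)) :=
  Finset.prod_Ico_succ_top h _

/-- The sum of the squared weights of the innovations at time `t`. -/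
def weightSum (m : ℕ) (α : ℝ) (t : ℕ) : ℝ :=
  ∑ k ∈ Finset.range t, (contraction m α (k + 1) t / ((m : ℝ) + k + 1)) ^ 2

theorem weightSum_succ (m : ℕ) (α : ℝ) (t : ℕ) :
    weightSum m α (t + 1) =
      (1 - α / ((m : ℝ) + t + 1)) ^ 2 * weightSum m α t + 1 / ((m : ℝ) + t + 1) ^ 2 := by
  rw [weightSum, Finset.sum_range_succ, contraction_self, div_pow, one_pow, weightSum,
    Finset.mul_sum]
  congr 1
  refine Finset.sum_congr rfl fun k hk => ?_
  rw [contraction_succ m α (Finset.mem_range.1 hk)]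
  ring

/-- Each squared factor is at most `n/(n+1)`, the worst case being `α = 1/2`, and these bounds
telescope. The estimate makes the scaled weights of late innovations uniformly small. -/
theorem contraction_sq_le {m : ℕ} {α : ℝ} (h₀ : 1 / 2 ≤ α) (h₁ : α ≤ 1) {k t : ℕ} (h : k ≤ t) :
    contraction m α k t ^ 2 ≤ ((m : ℝ) + k + 1) / ((m : ℝ) + t + 1) := by
  induction t, h using Nat.le_induction with
  | base => rw [contraction_self, div_self (by positivity)]; norm_num
  | succ t ht ih =>
    rw [contraction_succ m α ht, mul_pow]
    have hn : (1 : ℝ) ≤ (m : ℝ) + t + 1 := by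
      have : (0 : ℝ) ≤ (m : ℝ) + t := by positivity
      linarith
    have h2 : (1 - α / ((m : ℝ) + t + 1)) ^ 2 ≤ ((m : ℝ) + t + 1) / ((m : ℝ) + t + 1 + 1) := by
      set n : ℝ := (m : ℝ) + t + 1
      have hn0 : 0 < n := by linarith
      have h3 : 0 ≤ 1 - α / n := by rw [sub_nonneg, div_le_one hn0]; linarith
      have h4 : 1 - α / n ≤ 1 - 1 / 2 / n := by gcongr
      refine (pow_le_pow_left₀ h3 h4 2).trans ?_
      rw [le_div_iff₀ (by linarith)]
      have : (1 - 1 / 2 / n) ^ 2 * (n + 1) = n - (3 * n - 1) / (4 * n ^ 2) := by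
        field_simp
        ring
      rw [this]
      have : 0 ≤ (3 * n - 1) / (4 * n ^ 2) := div_nonneg (by linarith) (by positivity)
      linarith
    refine (mul_le_mul ih h2 (sq_nonneg _) (by positivity)).trans (le_of_eq ?_)
    have : (m : ℝ) + t + 1 ≠ 0 := by positivity
    push_cast
    rw [div_mul_div_cancel₀ this]
    ring

/-- With `n = m + t + 1`, the ratio `(n - α)²/(n(n - 1))` is `1 - (2α - 1)/n + O(1/n²)`. Half of the
linear term is given up to absorb the quadratic one. -/
theorem eventually_ratio_le (m : ℕ) {α : ℝ} (h₀ : 1 / 2 < α) :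
    ∀ᶠ t : ℕ in atTop, (((m : ℝ) + t + 1 - α) ^ 2) / ((m : ℝ) + t + 1) ≤
      (1 - (2 * α - 1) / 2 / ((m : ℝ) + t + 1)) * ((m : ℝ) + t) := by
  filter_upwards [(tendsto_natCast_add_atTop m).eventually_ge_atTop (2 * α ^ 2 / (2 * α - 1))]
    with t ht
  have hn : 0 < (m : ℝ) + t + 1 := by positivity
  have e : (m : ℝ) + t = (m : ℝ) + t + 1 - 1 := by ring
  rw [e]
  set n : ℝ := (m : ℝ) + t + 1
  rw [div_le_iff₀ (by linarith)] at ht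
  rw [sub_add_cancel, div_le_iff₀ hn]
  have : (1 - (2 * α - 1) / 2 / n) * (n - 1) * n = (n - (2 * α - 1) / 2) * (n - 1) := by
    field_simp
  rw [this]
  nlinarith

theorem tendsto_mul_contraction_sq (m : ℕ) {α : ℝ} (h₀ : 1 / 2 < α) (k : ℕ) :
    Tendsto (fun t : ℕ => ((m : ℝ) + t) * contraction m α k t ^ 2) atTop (𝓝 0) := by
  refine tendsto_zero_of_harmonic_contraction m (β := (2 * α - 1) / 2) (C := 0) (by linarith)
    (fun t => by positivity) ?_
  filter_upwards [eventually_ratio_le m h₀, eventually_ge_atTop k] with t ht hk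
  have hn : (m : ℝ) + t + 1 ≠ 0 := by positivity
  rw [contraction_succ m α hk, zero_div, add_zero]
  have := mul_le_mul_of_nonneg_right ht (sq_nonneg (contraction m α k t))
  refine (le_of_eq ?_).trans (this.trans (le_of_eq (by ring)))
  push_cast
  rw [← add_assoc]
  field_simp

/-- To first order `x t = (m + t) * weightSum m α t` satisfies `x (t+1) = (1 - (2α - 1)/n) x t +
1/n`, whose fixed point is `1/(2α - 1)`. The distance to it contracts harmonically. -/
theorem tendsto_mul_weightSum {m : ℕ} (hm : 1 ≤ m) {α : ℝ} (h₀ : 1 / 2 < α) :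
    Tendsto (fun t : ℕ => (t : ℝ) * weightSum m α t) atTop (𝓝 (1 / (2 * α - 1))) := by
  have hm' : (1 : ℝ) ≤ m := by exact_mod_cast hm
  have hβ : 0 < 2 * α - 1 := by linarith
  have key : Tendsto (fun t : ℕ => |((m : ℝ) + t) * weightSum m α t - 1 / (2 * α - 1)|) atTop
      (𝓝 0) := by
    refine tendsto_zero_of_harmonic_contraction m (β := (2 * α - 1) / 2)
      (C := 2 * |α ^ 2 / (2 * α - 1) - 1|) (by linarith) (fun t => abs_nonneg _) ?_
    filter_upwards [eventually_ratio_le m h₀, eventually_ge_atTop 1] with t ht ht1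
    have ht1' : (1 : ℝ) ≤ t := by exact_mod_cast ht1
    have e : (m : ℝ) + t = (m : ℝ) + t + 1 - 1 := by ring
    have hn : 2 ≤ (m : ℝ) + t + 1 := by linarith
    rw [weightSum_succ]
    push_cast
    rw [← add_assoc]
    rw [e, sub_add_cancel] at ht ⊢
    set n : ℝ := (m : ℝ) + t + 1
    set x := weightSum m α t
    have hn1 : n - 1 ≠ 0 := by linarith
    have hn0 : n ≠ 0 := by linarith
    have hβ0 := hβ.ne'
    -- Centring at the fixed point cancels every term of order `1/n`, leaving a residue of order
    -- `1/n²`.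
    have h1 : n * ((1 - α / n) ^ 2 * x + 1 / n ^ 2) - 1 / (2 * α - 1) =
        (n - α) ^ 2 / n / (n - 1) * ((n - 1) * x - 1 / (2 * α - 1)) +
          (α ^ 2 / (2 * α - 1) - 1) / (n * (n - 1)) := by
      obtain ⟨B, rfl⟩ : ∃ B, α = (B + 1) / 2 := ⟨2 * α - 1, by ring⟩
      have e2 : 2 * ((B + 1) / 2) - 1 = B := by ring
      rw [e2] at hβ0 ⊢
      field_simp
      ring
    rw [h1]
    refine (abs_add_le _ _).trans (add_le_add ?_ ?_)
    · rw [abs_mul]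
      refine mul_le_mul_of_nonneg_right ?_ (abs_nonneg _)
      rw [abs_of_nonneg (div_nonneg (div_nonneg (sq_nonneg _) (by linarith)) (by linarith)),
        div_le_iff₀ (by linarith)]
      exact ht
    · rw [abs_div, abs_of_nonneg (mul_nonneg (by linarith : 0 ≤ n) (by linarith : 0 ≤ n - 1)),
        div_le_div_iff₀ (by nlinarith) (by positivity)]
      nlinarith [abs_nonneg (α ^ 2 / (2 * α - 1) - 1),
        mul_nonneg (abs_nonneg (α ^ 2 / (2 * α - 1) - 1))
          (mul_nonneg (by linarith : 0 ≤ n) (by linarith : 0 ≤ n - 2))]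
  have h1 : Tendsto (fun t : ℕ => ((m : ℝ) + t) * weightSum m α t) atTop
      (𝓝 (1 / (2 * α - 1))) := by
    rw [tendsto_iff_norm_sub_tendsto_zero]
    exact key
  have h2 : Tendsto (fun t : ℕ => (t : ℝ) / ((m : ℝ) + t)) atTop (𝓝 1) := by
    have := tendsto_natCast_div_add_atTop (𝕜 := ℝ) (m : ℝ)
    refine this.congr fun t => by rw [add_comm]
  have h3 := h2.mul h1
  rw [one_mul] at h3
  refine h3.congr fun t => ?_
  have : (m : ℝ) + t ≠ 0 := by positivity
  field_simp

theorem tendsto_log_natCast_add_div_log (m : ℕ) :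
    Tendsto (fun t : ℕ => Real.log ((m : ℝ) + t) / Real.log t) atTop (𝓝 1) := by
  have hlog : Tendsto (fun t : ℕ => Real.log (t : ℝ)) atTop atTop :=
    Real.tendsto_log_atTop.comp tendsto_natCast_atTop_atTop
  have h2 : Tendsto (fun t : ℕ => (m : ℝ) / t + 1) atTop (𝓝 (0 + 1)) :=
    (tendsto_natCast_atTop_atTop.const_div_atTop _).add_const _
  rw [zero_add] at h2
  have h3 := (h2.log one_ne_zero).div_atTop hlog
  have h4 := h3.add_const 1
  rw [zero_add] at h4
  refine h4.congr' ?_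
  filter_upwards [eventually_gt_atTop 1, hlog.eventually_gt_atTop 0] with t ht hl
  have ht0 : (t : ℝ) ≠ 0 := by positivity
  have : (m : ℝ) + t = ((m : ℝ) / t + 1) * t := by field_simp
  rw [this, Real.log_mul (by positivity) ht0, add_div, div_self hl.ne']

/-- At `α = 1/2` the linear contraction cancels: `(m + t) * weightSum` grows by `1/(m + t + 1)` at
each step, up to a factor `1 + O(1/t²)`. It thus stays within a bounded distance of a harmonic sum,
hence of `log t`. -/
theorem tendsto_div_log_mul_weightSum {m : ℕ} (hm : 1 ≤ m) :
    Tendsto (fun t : ℕ => (t : ℝ) / Real.log t * weightSum m (1 / 2) t) atTop (𝓝 1) := by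
  have hm' : (1 : ℝ) ≤ m := by exact_mod_cast hm
  set h : ℕ → ℝ := fun t => ∑ k ∈ Finset.range t, 1 / ((m : ℝ) + k + 1) with hh
  have h0 : ∀ t, 0 ≤ h t := fun t => Finset.sum_nonneg fun _ _ => by positivity
  have hsucc : ∀ t, h (t + 1) = h t + 1 / ((m : ℝ) + t + 1) := fun t =>
    Finset.sum_range_succ _ _
  have hrec : ∀ t : ℕ, ((m : ℝ) + (t + 1 : ℕ)) * weightSum m (1 / 2) (t + 1) =
      ((m : ℝ) + t) * weightSum m (1 / 2) t *
        (1 + 1 / (4 * ((m : ℝ) + t + 1) * ((m : ℝ) + t))) + 1 / ((m : ℝ) + t + 1) := by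
    intro t
    rw [weightSum_succ]
    have h1 : (m : ℝ) + t + 1 ≠ 0 := by positivity
    have h2 : (m : ℝ) + t ≠ 0 := by positivity
    push_cast
    field_simp
    ring
  have hlower : ∀ t : ℕ, h t ≤ ((m : ℝ) + t) * weightSum m (1 / 2) t := by
    intro t
    induction t with
    | zero => simp [hh, weightSum]
    | succ t ih =>
      rw [hrec, hsucc]
      have hx : 0 ≤ ((m : ℝ) + t) * weightSum m (1 / 2) t := (h0 t).trans ih
      have : 0 ≤ 1 / (4 * ((m : ℝ) + t + 1) * ((m : ℝ) + t)) := by positivity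
      nlinarith
  -- The subtracted term makes the induction close: as its denominator grows it releases about
  -- `h/n²` (`n = m + t`), which pays for the multiplicative growth of about `h/(4n²)`.
  have hupper : ∀ t : ℕ, ((m : ℝ) + t) * weightSum m (1 / 2) t ≤
      h t + 2 - (h t + 3 / 2) / ((m : ℝ) + t) := by
    intro t
    induction t with
    | zero =>
      simp only [weightSum, Finset.range_zero, Finset.sum_empty, mul_zero, hh,
        Nat.cast_zero, add_zero, zero_add]
      rw [sub_nonneg, div_le_iff₀ (by linarith)]
      linarith
    | succ t ih =>
      rw [hrec, hsucc]
      have hn1 : 0 < (m : ℝ) + t := by positivity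
      push_cast
      rw [← add_assoc]
      have hH := h0 t
      set n : ℝ := (m : ℝ) + t
      set H := h t
      have hr : 0 ≤ 1 + 1 / (4 * (n + 1) * n) := by positivity
      refine (add_le_add_left (mul_le_mul_of_nonneg_right ih hr) _).trans ?_
      have e : H + 1 / (n + 1) + 2 - (H + 1 / (n + 1) + 3 / 2) / (n + 1) -
          ((H + 2 - (H + 3 / 2) / n) * (1 + 1 / (4 * (n + 1) * n)) + 1 / (n + 1)) =
          (3 * H * n * (n + 1) + (n + 1) * (4 * n) + (H + 3 / 2) * (n + 1) -
            4 * n ^ 2) / (4 * n ^ 2 * (n + 1) ^ 2) := by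
        field_simp
        ring
      have : 0 ≤ (3 * H * n * (n + 1) + (n + 1) * (4 * n) + (H + 3 / 2) * (n + 1) -
            4 * n ^ 2) / (4 * n ^ 2 * (n + 1) ^ 2) := by
        refine div_nonneg ?_ (by positivity)
        have : 0 ≤ 3 * H * n * (n + 1) := by positivity
        have : 0 ≤ (H + 3 / 2) * (n + 1) := by positivity
        nlinarith
      linarith
  have hharm : ∀ t : ℕ, h t = (harmonic (m + t) : ℝ) - harmonic m := by
    intro t
    induction t with
    | zero => simp [hh]
    | succ t ih =>
      rw [hsucc, ih, ← add_assoc, harmonic_succ]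
      push_cast
      rw [one_div]
      ring
  have hlog : Tendsto (fun t : ℕ => Real.log (t : ℝ)) atTop atTop :=
    Real.tendsto_log_atTop.comp tendsto_natCast_atTop_atTop
  have hdiff : Tendsto (fun t : ℕ => h t - Real.log ((m : ℝ) + t)) atTop
      (𝓝 (Real.eulerMascheroniConstant - harmonic m)) := by
    have h1 := (Real.tendsto_harmonic_sub_log.comp (tendsto_add_atTop_nat m)).sub_const
      ((harmonic m : ℚ) : ℝ)
    refine h1.congr fun t => ?_
    simp only [Function.comp_apply]
    rw [hharm, add_comm t m]
    push_cast
    ring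
  have hlim : Tendsto (fun t : ℕ => h t / Real.log t) atTop (𝓝 1) := by
    have := (hdiff.div_atTop hlog).add (tendsto_log_natCast_add_div_log m)
    rw [zero_add] at this
    refine this.congr fun t => ?_
    ring
  have hlim2 : Tendsto (fun t : ℕ => (h t + 2) / Real.log t) atTop (𝓝 1) := by
    have := hlim.add ((tendsto_const_nhds (x := (2 : ℝ))).div_atTop hlog)
    rw [add_zero] at this
    refine this.congr fun t => by rw [add_div]
  have hx : Tendsto (fun t : ℕ => ((m : ℝ) + t) * weightSum m (1 / 2) t / Real.log t) atTop
      (𝓝 1) := by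
    refine tendsto_of_tendsto_of_tendsto_of_le_of_le' hlim hlim2 ?_ ?_
    · filter_upwards [hlog.eventually_gt_atTop 0] with t ht
      exact div_le_div_of_nonneg_right (hlower t) ht.le
    · filter_upwards [hlog.eventually_gt_atTop 0] with t ht
      refine div_le_div_of_nonneg_right ((hupper t).trans ?_) ht.le
      have : 0 ≤ (h t + 3 / 2) / ((m : ℝ) + t) := div_nonneg (by linarith [h0 t]) (by positivity)
      linarith
  have h2 : Tendsto (fun t : ℕ => (t : ℝ) / ((m : ℝ) + t)) atTop (𝓝 1) := by
    have := tendsto_natCast_div_add_atTop (𝕜 := ℝ) (m : ℝ)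
    refine this.congr fun t => by rw [add_comm]
  have h3 := h2.mul hx
  rw [one_mul] at h3
  refine h3.congr fun t => ?_
  have : (m : ℝ) + t ≠ 0 := by positivity
  field_simp

end Deterministic

/-! ### Stable convergence of weighted sums of martingale differences -/

section StableCLT

/-- For `|x| ≥ 1` every term is bounded separately by a multiple of `|x|³`, so no smallness of `x`
is required. -/
theorem norm_exp_I_mul_sub_taylor_le (x : ℝ) :
    ‖Complex.exp (Complex.I * x) - (1 + Complex.I * x - (x : ℂ) ^ 2 / 2)‖ ≤ 4 * |x| ^ 3 := by
  have hn : ‖Complex.I * x‖ = |x| := by simp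
  rcases le_total |x| 1 with h | h
  · have := Complex.exp_bound (x := Complex.I * x) (by rwa [hn]) (n := 3) (by norm_num)
    rw [hn] at this
    have e : ∑ m ∈ Finset.range 3, (Complex.I * x) ^ m / (m.factorial : ℂ) =
        1 + Complex.I * x - (x : ℂ) ^ 2 / 2 := by
      simp [Finset.sum_range_succ, mul_pow]
      ring
    rw [e] at this
    refine this.trans ?_
    have h0 : 0 ≤ |x| ^ 3 := by positivity
    norm_num [Nat.factorial]
    nlinarith
  · have h1 : ‖Complex.exp (Complex.I * x)‖ = 1 := by
      rw [mul_comm]; exact Complex.norm_exp_ofReal_mul_I x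
    have h2 : ‖1 + Complex.I * x - (x : ℂ) ^ 2 / 2‖ ≤ 1 + |x| + |x| ^ 2 / 2 := by
      refine (norm_sub_le _ _).trans (add_le_add ((norm_add_le _ _).trans ?_) ?_)
      · simp
      · simp
    refine (norm_sub_le _ _).trans ?_
    rw [h1]
    have h3 : 1 ≤ |x| ^ 3 := one_le_pow₀ h
    have h4 : |x| ≤ |x| ^ 3 := le_self_pow₀ h (by norm_num)
    have h5 : |x| ^ 2 ≤ |x| ^ 3 := pow_le_pow_right₀ h (by norm_num)
    linarith

theorem abs_exp_neg_sub_le {y : ℝ} (hy : 0 ≤ y) : |Real.exp (-y) - (1 - y)| ≤ y ^ 2 := by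
  have h1 : 1 - y ≤ Real.exp (-y) := by have := Real.add_one_le_exp (-y); linarith
  rw [abs_of_nonneg (by linarith)]
  rcases le_total y 1 with h | h
  · have := Real.abs_exp_sub_one_sub_id_le (x := -y) (by rwa [abs_neg, abs_of_nonneg hy])
    have := (abs_le.1 this).2
    nlinarith
  · have : Real.exp (-y) ≤ 1 := Real.exp_le_one_iff.2 (by linarith)
    nlinarith

theorem abs_exp_neg_sub_exp_neg_le {x y : ℝ} (hx : 0 ≤ x) (hy : 0 ≤ y) :
    |Real.exp (-x) - Real.exp (-y)| ≤ |x - y| := by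
  wlog h : x ≤ y generalizing x y
  · rw [abs_sub_comm, abs_sub_comm x]
    exact this hy hx (le_of_not_ge h)
  rw [abs_of_nonneg (sub_nonneg.2 (Real.exp_le_exp.2 (by linarith))), abs_sub_comm,
    abs_of_nonneg (by linarith)]
  have e : Real.exp (-y) = Real.exp (-x) * Real.exp (-(y - x)) := by
    rw [← Real.exp_add]; ring_nf
  have h1 : 1 - (y - x) ≤ Real.exp (-(y - x)) := by
    have := Real.add_one_le_exp (-(y - x)); linarith
  have h2 : Real.exp (-x) ≤ 1 := Real.exp_le_one_iff.2 (by linarith)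
  have h3 := Real.exp_pos (-x)
  rw [e]
  nlinarith

variable {Ω : Type*} {m m0 : MeasurableSpace Ω} {P : Measure Ω}

/-- The pull-out property for a complex factor and a real conditional expectation, through the
bilinear action of `ℝ` on `ℂ`. -/
theorem integral_mul_ofReal_condExp [IsFiniteMeasure P] (hm : m ≤ m0) {G : Ω → ℂ} {f : Ω → ℝ}
    {M : ℝ} (hG : StronglyMeasurable[m] G) (hGb : ∀ᵐ ω ∂P, ‖G ω‖ ≤ M) (hf : Integrable f P) :
    ∫ ω, G ω * (f ω : ℂ) ∂P = ∫ ω, G ω * ((P[f|m]) ω : ℂ) ∂P := by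
  have hfg : Integrable (fun ω => G ω * (f ω : ℂ)) P :=
    hf.ofReal.bdd_mul (hG.mono hm).aestronglyMeasurable hGb
  have key := condExp_bilin_of_stronglyMeasurable_left (μ := P) (m := m)
    (ContinuousLinearMap.lsmul ℝ ℝ (E := ℂ)).flip (f := G) (g := f) hG
    (by simpa [mul_comm] using hfg) hf
  rw [← integral_condExp hm]
  refine integral_congr_ae ?_
  simp only [ContinuousLinearMap.flip_apply, ContinuousLinearMap.lsmul_apply,
    Complex.real_smul] at key
  filter_upwards [key] with ω hω
  rw [mul_comm (G ω), ← hω]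
  simp_rw [mul_comm]

theorem integral_ofReal_mul_condExp [IsFiniteMeasure P] (hm : m ≤ m0) {G : Ω → ℂ} {f : Ω → ℝ}
    {M : ℝ} (hG : StronglyMeasurable[m] G) (hGb : ∀ᵐ ω ∂P, ‖G ω‖ ≤ M) (hf : Integrable f P) :
    ∫ ω, (f ω : ℂ) * G ω ∂P = ∫ ω, ((P[f|m]) ω : ℂ) * G ω ∂P := by
  simp_rw [mul_comm _ (G _)]
  exact integral_mul_ofReal_condExp hm hG hGb hf

/-- One step of the Lindeberg replacement: a bounded martingale difference may be replaced by
a Gaussian variable whose variance is close to its conditional variance. -/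
theorem norm_integral_exp_sub_exp_le [IsProbabilityMeasure P] (hm : m ≤ m0) {G : Ω → ℂ}
    {ε q q' : Ω → ℝ} {M B : ℝ} (hG : StronglyMeasurable[m] G)
    (hGb : ∀ᵐ ω ∂P, ‖G ω‖ ≤ M) (hM : 0 ≤ M)
    (hε : Measurable ε) (hεb : ∀ ω, |ε ω| ≤ B) (hε0 : P[ε|m] =ᵐ[P] 0)
    (hq : StronglyMeasurable[m] q) (hqb : ∀ ω, 0 ≤ q ω ∧ q ω ≤ B ^ 2)
    (hεq : P[ε ^ 2|m] =ᵐ[P] q)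
    (hq' : StronglyMeasurable[m] q') (hqb' : ∀ ω, 0 ≤ q' ω ∧ q' ω ≤ B ^ 2) (w : ℝ) :
    ‖∫ ω, G ω * (Complex.exp (Complex.I * (w * ε ω : ℝ)) -
        (Real.exp (-(w ^ 2 / 2 * q' ω)) : ℝ)) ∂P‖ ≤
      M * (w ^ 2 * (4 * B ^ 3 * |w| + B ^ 4 * w ^ 2 + ∫ ω, |q ω - q' ω| ∂P)) := by
  have hqm := (hq.mono hm).measurable
  have hqm' := (hq'.mono hm).measurable
  have hGm := (hG.mono hm).measurable
  have hεi : Integrable ε P := Integrable.of_bound hε.aestronglyMeasurable B (ae_of_all _ hεb)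
  have hεi2 : Integrable (ε ^ 2) P :=
    Integrable.of_bound (hε.pow_const 2).aestronglyMeasurable (B ^ 2) (ae_of_all _ fun ω => by
      rw [Pi.pow_apply, Real.norm_eq_abs, abs_pow]; exact pow_le_pow_left₀ (abs_nonneg _) (hεb ω) 2)
  have hqi : Integrable q P := Integrable.of_bound hqm.aestronglyMeasurable (B ^ 2)
    (ae_of_all _ fun ω => by rw [Real.norm_eq_abs, abs_of_nonneg (hqb ω).1]; exact (hqb ω).2)
  have hqi' : Integrable q' P := Integrable.of_bound hqm'.aestronglyMeasurable (B ^ 2)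
    (ae_of_all _ fun ω => by rw [Real.norm_eq_abs, abs_of_nonneg (hqb' ω).1]; exact (hqb' ω).2)
  have hGi : ∀ {f : Ω → ℂ}, Integrable f P → Integrable (fun ω => G ω * f ω) P := fun hf =>
    hf.bdd_mul hGm.aestronglyMeasurable hGb
  have z1 : ∫ ω, G ω * (ε ω : ℂ) ∂P = 0 := by
    rw [integral_mul_ofReal_condExp hm hG hGb hεi, ← integral_zero Ω ℂ]
    refine integral_congr_ae ?_
    filter_upwards [hε0] with ω hω
    simp [hω]
  have z2 : ∫ ω, G ω * ((ε ω ^ 2 - q ω : ℝ) : ℂ) ∂P = 0 := by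
    have h1 := integral_mul_ofReal_condExp hm hG hGb hεi2
    have h2 : ∫ ω, G ω * (((P[ε ^ 2|m]) ω : ℝ) : ℂ) ∂P = ∫ ω, G ω * (q ω : ℂ) ∂P :=
      integral_congr_ae (by filter_upwards [hεq] with ω hω; rw [hω])
    rw [h2] at h1
    simp only [Complex.ofReal_sub, mul_sub]
    have i2 : Integrable (fun ω => G ω * ((ε ω ^ 2 : ℝ) : ℂ)) P := hGi hεi2.ofReal
    have i3 : Integrable (fun ω => G ω * (q ω : ℂ)) P := hGi hqi.ofReal
    rw [integral_sub i2 i3, sub_eq_zero]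
    exact h1
  -- Subtracting the second-order expansions leaves this remainder plus multiples of `ε` and `ε² -
  -- q`. Both integrate to zero against `G` (`z1`, `z2`), so only `R` has to be estimated.
  set R : Ω → ℂ := fun ω =>
    (Complex.exp (Complex.I * (w * ε ω : ℝ)) -
      (1 + Complex.I * (w * ε ω : ℝ) - ((w * ε ω : ℝ) : ℂ) ^ 2 / 2)) -
    ((Real.exp (-(w ^ 2 / 2 * q' ω)) - (1 - w ^ 2 / 2 * q' ω) : ℝ) : ℂ) -
    ((w ^ 2 / 2 * (q ω - q' ω) : ℝ) : ℂ) with hR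
  have hRb : ∀ ω, ‖R ω‖ ≤ w ^ 2 * (4 * B ^ 3 * |w| + B ^ 4 * w ^ 2) + w ^ 2 * |q ω - q' ω| := by
    intro ω
    refine (norm_sub_le _ _).trans (add_le_add ((norm_sub_le _ _).trans ?_) ?_)
    · rw [mul_add]
      refine add_le_add ((norm_exp_I_mul_sub_taylor_le _).trans ?_) ?_
      · rw [abs_mul, mul_pow]
        have h1 := pow_le_pow_left₀ (abs_nonneg _) (hεb ω) 3
        have h2 : w ^ 2 = |w| ^ 2 := (sq_abs w).symm
        rw [h2]
        have h3 : 0 ≤ |w| ^ 3 := by positivity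
        nlinarith
      · rw [Complex.norm_real, Real.norm_eq_abs]
        have h0 : 0 ≤ w ^ 2 / 2 * q' ω := mul_nonneg (by positivity) (hqb' ω).1
        refine (abs_exp_neg_sub_le h0).trans ?_
        have h1 : w ^ 2 / 2 * q' ω ≤ w ^ 2 * B ^ 2 := by
          have := mul_le_mul_of_nonneg_left (hqb' ω).2 (sq_nonneg w)
          linarith [mul_nonneg (sq_nonneg w) (hqb' ω).1]
        refine (pow_le_pow_left₀ h0 h1 2).trans (le_of_eq (by ring))
    · rw [Complex.norm_real, Real.norm_eq_abs, abs_mul, abs_of_nonneg (by positivity)]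
      have : 0 ≤ w ^ 2 * |q ω - q' ω| := by positivity
      linarith
  have hRm : Measurable R := by
    rw [hR]
    fun_prop
  have hdi : Integrable (fun ω => |q ω - q' ω|) P := (hqi.sub hqi').abs
  have hbi : Integrable (fun ω => w ^ 2 * (4 * B ^ 3 * |w| + B ^ 4 * w ^ 2) +
      w ^ 2 * |q ω - q' ω|) P := (integrable_const _).add (hdi.const_mul _)
  have hRi : Integrable R P := hbi.mono' hRm.aestronglyMeasurable (ae_of_all _ hRb)
  have e : ∀ ω, G ω * (Complex.exp (Complex.I * (w * ε ω : ℝ)) -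
        (Real.exp (-(w ^ 2 / 2 * q' ω)) : ℝ)) =
      G ω * R ω + (Complex.I * w) * (G ω * (ε ω : ℂ)) -
        ((w : ℂ) ^ 2 / 2) * (G ω * ((ε ω ^ 2 - q ω : ℝ) : ℂ)) := by
    intro ω
    simp only [hR]
    push_cast
    ring
  simp_rw [e]
  have i1 : Integrable (fun ω => Complex.I * w * (G ω * (ε ω : ℂ))) P :=
    (hGi hεi.ofReal).const_mul _
  have i2 : Integrable (fun ω => (w : ℂ) ^ 2 / 2 * (G ω * ((ε ω ^ 2 - q ω : ℝ) : ℂ))) P :=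
    (hGi (hεi2.sub hqi).ofReal).const_mul _
  have i3 : Integrable (fun ω => G ω * R ω + Complex.I * w * (G ω * (ε ω : ℂ))) P :=
    (hGi hRi).add i1
  rw [integral_sub i3 i2, integral_add (hGi hRi) i1, integral_const_mul, integral_const_mul,
    z1, z2, mul_zero, mul_zero, add_zero, sub_zero]
  refine (norm_integral_le_of_norm_le (hbi.const_mul M) ?_).trans (le_of_eq ?_)
  · filter_upwards [hGb] with ω hω
    rw [norm_mul]
    exact mul_le_mul hω (hRb ω) (norm_nonneg _) hM
  · rw [integral_const_mul, integral_add (integrable_const _) (hdi.const_mul _),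
      integral_const, integral_const_mul, probReal_univ, one_smul]
    ring

/-- A bounded martingale difference sequence `ε` with conditional variances `q`, where `ε k` is
the increment from time `k` to time `k + 1`. -/
structure IsBoundedDifference (P : Measure Ω) (ℱ : Filtration ℕ m0) (B : ℝ) (ε q : ℕ → Ω → ℝ) :
    Prop where
  meas : ∀ k, StronglyMeasurable[ℱ (k + 1)] (ε k)
  bound : ∀ k ω, |ε k ω| ≤ B
  condExp_eq_zero : ∀ k, P[ε k|ℱ k] =ᵐ[P] 0
  meas_var : ∀ k, StronglyMeasurable[ℱ k] (q k)
  var_bound : ∀ k ω, 0 ≤ q k ω ∧ q k ω ≤ B ^ 2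
  condExp_sq : ∀ k, P[ε k ^ 2|ℱ k] =ᵐ[P] q k

namespace IsBoundedDifference

variable {ℱ : Filtration ℕ m0} {B : ℝ} {ε q : ℕ → Ω → ℝ}

theorem measurable (hε : IsBoundedDifference P ℱ B ε q) (k : ℕ) : Measurable (ε k) :=
  ((hε.meas k).mono (ℱ.le _)).measurable

theorem measurable_var (hε : IsBoundedDifference P ℱ B ε q) (k : ℕ) : Measurable (q k) :=
  ((hε.meas_var k).mono (ℱ.le _)).measurable

theorem integrable_var [IsFiniteMeasure P] (hε : IsBoundedDifference P ℱ B ε q) (k : ℕ) :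
    Integrable (q k) P :=
  Integrable.of_bound (hε.measurable_var k).aestronglyMeasurable (B ^ 2)
    (ae_of_all _ fun ω => by
      rw [Real.norm_eq_abs, abs_of_nonneg (hε.var_bound k ω).1]; exact (hε.var_bound k ω).2)

theorem stronglyMeasurable_sum (hε : IsBoundedDifference P ℱ B ε q) (w : ℕ → ℝ)
    (I : Finset ℕ) {t : ℕ} (hI : ∀ k ∈ I, k < t) :
    StronglyMeasurable[ℱ t] (fun ω => ∑ k ∈ I, w k * ε k ω) :=
  Finset.stronglyMeasurable_fun_sum _ fun k hk =>
    ((hε.meas k).mono (ℱ.mono (hI k hk))).const_mul _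

/-- Lindeberg replacement from the last index downwards. Each replaced factor becomes `exp (-w²/2 *
q s)`, which is measurable at time `s` and so can join the prefactor for the next replacement. The
free parameter `τ` accumulates these variances and must be general for the induction. -/
theorem norm_integral_sub_le [IsProbabilityMeasure P] (hε : IsBoundedDifference P ℱ B ε q)
    {h : Ω → ℝ} {s : ℕ} (hh : StronglyMeasurable[ℱ s] h)
    (hhb : ∀ᵐ ω ∂P, |h ω| ≤ 1) (w : ℕ → ℝ) {t : ℕ} (hst : s ≤ t) :
    ∀ τ : ℝ, 0 ≤ τ →
    ‖(∫ ω, (h ω : ℂ) * (Complex.exp (Complex.I * (∑ k ∈ Finset.Ico s t, w k * ε k ω : ℝ)) *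
        (Real.exp (-(τ / 2 * q s ω)) : ℝ)) ∂P) -
      ∫ ω, (h ω : ℂ) *
        (Real.exp (-((τ + ∑ k ∈ Finset.Ico s t, w k ^ 2) / 2 * q s ω)) : ℝ) ∂P‖ ≤
      ∑ k ∈ Finset.Ico s t,
        w k ^ 2 * (4 * B ^ 3 * |w k| + B ^ 4 * w k ^ 2 + ∫ ω, |q k ω - q s ω| ∂P) := by
  induction t, hst using Nat.le_induction with
  | base => intro τ hτ; simp
  | succ t hst ih =>
    intro τ hτ
    rw [Finset.sum_Ico_succ_top hst, Finset.sum_Ico_succ_top hst]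
    set G : Ω → ℂ := fun ω => (h ω : ℂ) *
      (Complex.exp (Complex.I * (∑ k ∈ Finset.Ico s t, w k * ε k ω : ℝ)) *
        (Real.exp (-(τ / 2 * q s ω)) : ℝ)) with hG
    have hqs : StronglyMeasurable[ℱ t] (q s) := (hε.meas_var s).mono (ℱ.mono hst)
    have hGm : StronglyMeasurable[ℱ t] G := by
      have h1 : Measurable[ℱ t] h := (hh.mono (ℱ.mono hst)).measurable
      have h2 : Measurable[ℱ t] (fun ω => ∑ k ∈ Finset.Ico s t, w k * ε k ω) :=
        (hε.stronglyMeasurable_sum w _ fun k hk => (Finset.mem_Ico.1 hk).2).measurable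
      have h3 : Measurable[ℱ t] (q s) := hqs.measurable
      refine Measurable.stronglyMeasurable ?_
      exact (Complex.measurable_ofReal.comp h1).mul
        ((Complex.measurable_exp.comp
          ((Complex.measurable_ofReal.comp h2).const_mul Complex.I)).mul
          (Complex.measurable_ofReal.comp (Real.measurable_exp.comp (h3.const_mul (τ / 2)).neg)))
    have hexp : ∀ x : ℝ, ‖Complex.exp (Complex.I * x)‖ = 1 := fun x => by
      rw [mul_comm]; exact Complex.norm_exp_ofReal_mul_I x
    have hGb : ∀ᵐ ω ∂P, ‖G ω‖ ≤ 1 := by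
      filter_upwards [hhb] with ω hω
      simp only [hG]
      rw [norm_mul, norm_mul, Complex.norm_real, hexp, one_mul, Complex.norm_real,
        Real.norm_eq_abs, Real.norm_eq_abs, Real.abs_exp]
      exact mul_le_one₀ hω (Real.exp_nonneg _) (Real.exp_le_one_iff.2 (by
        have := mul_nonneg (half_pos one_pos).le (mul_nonneg hτ (hε.var_bound s ω).1)
        linarith))
    have step := norm_integral_exp_sub_exp_le (ℱ.le t) hGm hGb zero_le_one (hε.measurable t)
      (hε.bound t) (hε.condExp_eq_zero t) (hε.meas_var t) (hε.var_bound t) (hε.condExp_sq t)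
      hqs (hε.var_bound s) (w t)
    have hGi : Integrable G P :=
      Integrable.of_bound (hGm.mono (ℱ.le t)).aestronglyMeasurable 1 hGb
    have hi1 : Integrable (fun ω => G ω * Complex.exp (Complex.I * (w t * ε t ω : ℝ))) P := by
      refine hGi.mul_bdd (c := 1) ?_ (ae_of_all _ fun ω => (hexp _).le)
      have := hε.measurable t
      exact Measurable.aestronglyMeasurable (by fun_prop)
    have hi2 : Integrable (fun ω => G ω * (Real.exp (-(w t ^ 2 / 2 * q s ω)) : ℝ)) P := by
      refine hGi.mul_bdd (c := 1) ?_ (ae_of_all _ fun ω => ?_)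
      · have := hε.measurable_var s
        exact Measurable.aestronglyMeasurable (by fun_prop)
      · rw [Complex.norm_real, Real.norm_eq_abs, Real.abs_exp]
        exact Real.exp_le_one_iff.2 (neg_nonpos.2 (mul_nonneg (by positivity)
          (hε.var_bound s ω).1))
    simp_rw [mul_sub] at step
    rw [integral_sub hi1 hi2, one_mul] at step
    have := ih (τ + w t ^ 2) (by positivity)
    have e1 : ∀ ω, (h ω : ℂ) *
        (Complex.exp (Complex.I * (∑ k ∈ Finset.Ico s (t + 1), w k * ε k ω : ℝ)) *
        (Real.exp (-(τ / 2 * q s ω)) : ℝ)) =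
        G ω * Complex.exp (Complex.I * (w t * ε t ω : ℝ)) := by
      intro ω
      rw [Finset.sum_Ico_succ_top hst]
      simp only [hG]
      rw [Complex.ofReal_add, mul_add, Complex.exp_add]
      ring
    have e2 : ∀ ω, (h ω : ℂ) *
        (Complex.exp (Complex.I * (∑ k ∈ Finset.Ico s t, w k * ε k ω : ℝ)) *
        (Real.exp (-((τ + w t ^ 2) / 2 * q s ω)) : ℝ)) =
        G ω * (Real.exp (-(w t ^ 2 / 2 * q s ω)) : ℝ) := by
      intro ω
      have : -((τ + w t ^ 2) / 2 * q s ω) = -(τ / 2 * q s ω) + -(w t ^ 2 / 2 * q s ω) := by ring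
      simp only [hG]
      rw [this, Real.exp_add]
      push_cast
      ring
    simp_rw [e2] at this
    simp_rw [e1]
    have e3 : τ + w t ^ 2 + ∑ k ∈ Finset.Ico s t, w k ^ 2 =
      τ + (∑ k ∈ Finset.Ico s t, w k ^ 2 + w t ^ 2) := by ring
    rw [e3] at this
    refine (norm_sub_le_norm_sub_add_norm_sub _ _ _).trans ((add_le_add step this).trans ?_)
    rw [add_comm]

end IsBoundedDifference

/-- The Cauchy form of L¹ convergence: it bounds the cost of freezing at time `s`, uniformly over
later times. -/
theorem eventually_forall_integral_abs_sub_le {f : ℕ → Ω → ℝ} {g : Ω → ℝ}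
    (hf : ∀ n, Integrable (f n) P) (hg : Integrable g P)
    (h : Tendsto (fun n => ∫ ω, |f n ω - g ω| ∂P) atTop (𝓝 0)) {η : ℝ} (hη : 0 < η) :
    ∀ᶠ s in atTop, ∀ t, s ≤ t → ∫ ω, |f t ω - f s ω| ∂P ≤ η := by
  have h1 := h.eventually_le_const (half_pos hη)
  obtain ⟨s₀, hs₀⟩ := eventually_atTop.1 h1
  filter_upwards [eventually_ge_atTop s₀] with s hs t ht
  have h2 := hs₀ s hs
  have h3 := hs₀ t (hs.trans ht)
  have i1 : ∀ n, Integrable (fun ω => |f n ω - g ω|) P := fun n => ((hf n).sub hg).abs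
  calc ∫ ω, |f t ω - f s ω| ∂P ≤ ∫ ω, (|f t ω - g ω| + |f s ω - g ω|) ∂P := by
        refine integral_mono ((hf t).sub (hf s)).abs ((i1 t).add (i1 s)) fun ω => ?_
        have := abs_sub_le (f t ω) (g ω) (f s ω)
        rwa [abs_sub_comm (g ω)] at this
    _ = _ := integral_add (i1 t) (i1 s)
    _ ≤ η := by linarith

/-- Lévy's upward theorem. The limit need not be `h`, but only the Cauchy property is used later, so
events outside the filtration are allowed in stable convergence. -/
theorem tendsto_integral_abs_condExp_sub [IsFiniteMeasure P] (ℱ : Filtration ℕ m0) (h : Ω → ℝ) :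
    Tendsto (fun n => ∫ ω, |(P[h|ℱ n]) ω - (P[h|⨆ n, ℱ n]) ω| ∂P) atTop (𝓝 0) := by
  have h1 := (ENNReal.tendsto_toReal ENNReal.zero_ne_top).comp
    (tendsto_eLpNorm_condExp (μ := P) (ℱ := ℱ) h)
  refine h1.congr fun n => ?_
  have hi : Integrable (P[h|ℱ n] - P[h|⨆ n, ℱ n]) P := integrable_condExp.sub integrable_condExp
  simp only [Function.comp_apply]
  rw [eLpNorm_one_eq_lintegral_enorm, ← integral_norm_eq_lintegral_enorm hi.1]
  rfl

end StableCLT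

/-! ### From the replacement bound to the stable central limit theorem. -/

section StableLimit

variable {Ω : Type*} {m0 : MeasurableSpace Ω} {P : Measure Ω}

theorem norm_exp_I_mul_ofReal (x : ℝ) : ‖Complex.exp (Complex.I * x)‖ = 1 := by
  rw [mul_comm]; exact Complex.norm_exp_ofReal_mul_I x

theorem norm_exp_I_mul_sub_exp_I_mul_le (x y : ℝ) :
    ‖Complex.exp (Complex.I * x) - Complex.exp (Complex.I * y)‖ ≤ |x - y| := by
  have e : Complex.exp (Complex.I * x) - Complex.exp (Complex.I * y) =
      Complex.exp (Complex.I * y) * (Complex.exp (Complex.I * (x - y : ℝ)) - 1) := by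
    rw [mul_sub, ← Complex.exp_add, mul_one]
    congr 2
    push_cast
    ring
  rw [e, norm_mul, norm_exp_I_mul_ofReal, one_mul]
  exact Real.norm_exp_I_mul_ofReal_sub_one_le

theorem norm_integral_ofReal_mul_sub_le {h h' : Ω → ℝ} {F : Ω → ℂ} (hh : Integrable h P)
    (hh' : Integrable h' P) (hF : AEStronglyMeasurable F P) (hFb : ∀ᵐ ω ∂P, ‖F ω‖ ≤ 1) :
    ‖(∫ ω, (h ω : ℂ) * F ω ∂P) - ∫ ω, (h' ω : ℂ) * F ω ∂P‖ ≤ ∫ ω, |h ω - h' ω| ∂P := by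
  have i1 : Integrable (fun ω => (h ω : ℂ) * F ω) P := hh.ofReal.mul_bdd hF hFb
  have i2 : Integrable (fun ω => (h' ω : ℂ) * F ω) P := hh'.ofReal.mul_bdd hF hFb
  rw [← integral_sub i1 i2]
  refine norm_integral_le_of_norm_le (hh.sub hh').abs ?_
  filter_upwards [hFb] with ω hω
  rw [← sub_mul, norm_mul, ← Complex.ofReal_sub, Complex.norm_real]
  exact mul_le_of_le_one_right (norm_nonneg _) hω

theorem norm_integral_mul_sub_le {h : Ω → ℝ} {F F' : Ω → ℂ} {g : Ω → ℝ}
    (hh : AEStronglyMeasurable h P)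
    (hhb : ∀ᵐ ω ∂P, |h ω| ≤ 1) (hF : Integrable F P) (hF' : Integrable F' P)
    (hg : Integrable g P) (hgb : ∀ᵐ ω ∂P, ‖F ω - F' ω‖ ≤ g ω) :
    ‖(∫ ω, (h ω : ℂ) * F ω ∂P) - ∫ ω, (h ω : ℂ) * F' ω ∂P‖ ≤ ∫ ω, g ω ∂P := by
  have hm : AEStronglyMeasurable (fun ω => (h ω : ℂ)) P :=
    Complex.continuous_ofReal.comp_aestronglyMeasurable hh
  have hb : ∀ᵐ ω ∂P, ‖(h ω : ℂ)‖ ≤ 1 := by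
    filter_upwards [hhb] with ω hω
    rwa [Complex.norm_real]
  have i1 : Integrable (fun ω => (h ω : ℂ) * F ω) P := hF.bdd_mul hm hb
  have i2 : Integrable (fun ω => (h ω : ℂ) * F' ω) P := hF'.bdd_mul hm hb
  rw [← integral_sub i1 i2]
  refine norm_integral_le_of_norm_le hg ?_
  filter_upwards [hb, hgb] with ω h1 h2
  rw [← mul_sub, norm_mul]
  exact (mul_le_of_le_one_left (norm_nonneg _) h1).trans h2

/-- Convergence of the characteristic functions, against a bounded function, of weighted sums of
bounded martingale differences whose conditional variances converge. -/
theorem IsBoundedDifference.tendsto_integral_exp [IsProbabilityMeasure P] {ℱ : Filtration ℕ m0}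
    {B : ℝ} {ε q : ℕ → Ω → ℝ} (hε : IsBoundedDifference P ℱ B ε q)
    {w : ℕ → ℕ → ℝ} {c : ℝ}
    (hsum : Tendsto (fun t => ∑ k ∈ Finset.range t, w t k ^ 2) atTop (𝓝 c))
    (hfix : ∀ k, Tendsto (fun t => w t k) atTop (𝓝 0))
    (hsmall : ∀ η : ℝ, 0 < η → ∀ᶠ s in atTop, ∀ᶠ t in atTop, ∀ k, s ≤ k → k < t → |w t k| ≤ η)
    {V : Ω → ℝ} (hV : Integrable V P) (hV0 : ∀ᵐ ω ∂P, 0 ≤ V ω)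
    (hqV : Tendsto (fun s => ∫ ω, |q s ω - V ω| ∂P) atTop (𝓝 0))
    {h : Ω → ℝ} (hh : Measurable h) (hhb : ∀ ω, |h ω| ≤ 1) :
    Tendsto (fun t => ∫ ω, (h ω : ℂ) *
        Complex.exp (Complex.I * (∑ k ∈ Finset.range t, w t k * ε k ω : ℝ)) ∂P) atTop
      (𝓝 (∫ ω, (h ω : ℂ) * (Real.exp (-(c / 2 * V ω)) : ℝ) ∂P)) := by
  have hc : 0 ≤ c := ge_of_tendsto' hsum fun t => Finset.sum_nonneg fun _ _ => sq_nonneg _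
  have hB : 0 ≤ B := by
    obtain ⟨ω⟩ : Nonempty Ω := by
      by_contra hne
      rw [not_nonempty_iff] at hne
      have := measure_univ (μ := P)
      rw [Set.univ_eq_empty_iff.2 hne, measure_empty] at this
      exact zero_ne_one this
    exact (abs_nonneg _).trans (hε.bound 0 ω)
  have hhi : Integrable h P := Integrable.of_bound hh.aestronglyMeasurable 1 (ae_of_all _ hhb)
  set hc' : ℕ → Ω → ℝ := fun s => P[h|ℱ s] with hhc
  have hci : ∀ s, Integrable (hc' s) P := fun s => integrable_condExp
  have hcm : ∀ s, StronglyMeasurable[ℱ s] (hc' s) := fun s => stronglyMeasurable_condExp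
  have hcb : ∀ s, ∀ᵐ ω ∂P, |hc' s ω| ≤ 1 := fun s =>
    ae_bdd_abs_condExp_of_ae_bdd_abs (ae_of_all _ hhb)
  have hmS : ∀ t (I : Finset ℕ), Measurable fun ω => ∑ k ∈ I, w t k * ε k ω := fun t I =>
    Finset.measurable_fun_sum _ fun k _ => (hε.measurable k).const_mul _
  have hmE : ∀ t (I : Finset ℕ), Measurable fun ω =>
      Complex.exp (Complex.I * (∑ k ∈ I, w t k * ε k ω : ℝ)) := fun t I =>
    Complex.measurable_exp.comp ((Complex.measurable_ofReal.comp (hmS t I)).const_mul _)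
  have hbE : ∀ t (I : Finset ℕ), ∀ᵐ ω ∂P,
      ‖Complex.exp (Complex.I * (∑ k ∈ I, w t k * ε k ω : ℝ))‖ ≤ 1 := fun t I =>
    ae_of_all _ fun ω => (norm_exp_I_mul_ofReal _).le
  have hmG : ∀ s (a : ℝ), Measurable[ℱ s] fun ω => ((Real.exp (-(a / 2 * q s ω)) : ℝ) : ℂ) :=
    fun s a => Complex.measurable_ofReal.comp
      (Real.measurable_exp.comp ((hε.meas_var s).measurable.const_mul _).neg)
  have hbG : ∀ s (a : ℝ), 0 ≤ a → ∀ᵐ ω ∂P, ‖((Real.exp (-(a / 2 * q s ω)) : ℝ) : ℂ)‖ ≤ 1 :=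
    fun s a ha => ae_of_all _ fun ω => by
      rw [Complex.norm_real, Real.norm_eq_abs, Real.abs_exp]
      exact Real.exp_le_one_iff.2 (neg_nonpos.2
        (mul_nonneg (by positivity) (hε.var_bound s ω).1))
  have hiG : ∀ s (a : ℝ), 0 ≤ a →
      Integrable (fun ω => ((Real.exp (-(a / 2 * q s ω)) : ℝ) : ℂ)) P :=
    fun s a ha => Integrable.of_bound ((hmG s a).mono (ℱ.le s) le_rfl).aestronglyMeasurable 1
      (hbG s a ha)
  have hiV : Integrable (fun ω => ((Real.exp (-(c / 2 * V ω)) : ℝ) : ℂ)) P := by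
    refine Integrable.of_bound ?_ 1 ?_
    · exact Complex.continuous_ofReal.comp_aestronglyMeasurable
        (Real.continuous_exp.comp_aestronglyMeasurable (hV.1.const_mul _).neg)
    · filter_upwards [hV0] with ω hω
      rw [Complex.norm_real, Real.norm_eq_abs, Real.abs_exp]
      exact Real.exp_le_one_iff.2 (neg_nonpos.2 (mul_nonneg (by positivity) hω))
  -- The sum of the constants in the five error bounds `d1` to `d5` below.
  set K : ℝ := 1 + 1 + (c + 1) * (4 * B ^ 3 + B ^ 4 + 1) + B ^ 2 + c with hK
  have hK0 : 0 < K := by positivity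
  have main : ∀ η : ℝ, 0 < η → η ≤ 1 → ∀ᶠ t in atTop,
      ‖(∫ ω, (h ω : ℂ) *
        Complex.exp (Complex.I * (∑ k ∈ Finset.range t, w t k * ε k ω : ℝ)) ∂P) -
      ∫ ω, (h ω : ℂ) * (Real.exp (-(c / 2 * V ω)) : ℝ) ∂P‖ ≤ K * η := by
    intro η hη hη1
    have a1 := eventually_forall_integral_abs_sub_le hci integrable_condExp
      (tendsto_integral_abs_condExp_sub (P := P) ℱ h) hη
    have a2 := eventually_forall_integral_abs_sub_le hε.integrable_var hV hqV hη
    -- The freezing time `s` depends on `η` only; `t` is sent to infinity afterwards, which removes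
    -- the terms before `s`.
    obtain ⟨s, s1, s2, s3, s4⟩ :=
      (a1.and (a2.and ((hqV.eventually_le_const hη).and (hsmall η hη)))).exists
    have b1 : Tendsto (fun t => ∑ k ∈ Finset.range s, |w t k| * B) atTop (𝓝 0) := by
      have := tendsto_finsetSum (Finset.range s) fun k _ => ((hfix k).abs.mul_const B)
      simpa using this
    have b2 : Tendsto (fun t => ∑ k ∈ Finset.range s, w t k ^ 2) atTop (𝓝 0) := by
      have := tendsto_finsetSum (Finset.range s) fun k _ => ((hfix k).pow 2)
      simpa using this
    have b3 : Tendsto (fun t => ∑ k ∈ Finset.Ico s t, w t k ^ 2) atTop (𝓝 c) := by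
      have := hsum.sub b2
      rw [sub_zero] at this
      refine this.congr' ?_
      filter_upwards [eventually_ge_atTop s] with t ht
      rw [Finset.sum_Ico_eq_sub _ ht]
    have b3' : ∀ᶠ t in atTop, |∑ k ∈ Finset.Ico s t, w t k ^ 2 - c| ≤ η := by
      have := (b3.sub_const c).abs
      rw [sub_self, abs_zero] at this
      exact this.eventually_le_const hη
    filter_upwards [s4, b1.eventually_le_const hη, b3', eventually_ge_atTop s] with t t1 t2 t3 hst
    set Q := ∑ k ∈ Finset.Ico s t, w t k ^ 2 with hQ
    have hQ0 : 0 ≤ Q := Finset.sum_nonneg fun _ _ => sq_nonneg _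
    have hQ1 : Q ≤ c + 1 := by have := (abs_le.1 t3).2; linarith
    -- replace `h` by its conditional expectations
    have e1 : ∫ ω, (h ω : ℂ) *
        Complex.exp (Complex.I * (∑ k ∈ Finset.range t, w t k * ε k ω : ℝ)) ∂P =
        ∫ ω, (hc' t ω : ℂ) *
        Complex.exp (Complex.I * (∑ k ∈ Finset.range t, w t k * ε k ω : ℝ)) ∂P := by
      refine integral_ofReal_mul_condExp (ℱ.le t) ?_ (hbE t _) hhi
      exact (Complex.measurable_exp.comp ((Complex.measurable_ofReal.comp
        (hε.stronglyMeasurable_sum (w t) _ fun k hk =>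
          Finset.mem_range.1 hk).measurable).const_mul _)).stronglyMeasurable
    have e2 : ∫ ω, (h ω : ℂ) * (Real.exp (-(c / 2 * q s ω)) : ℝ) ∂P =
        ∫ ω, (hc' s ω : ℂ) * (Real.exp (-(c / 2 * q s ω)) : ℝ) ∂P :=
      integral_ofReal_mul_condExp (ℱ.le s) (hmG s c).stronglyMeasurable (hbG s c hc) hhi
    have d1 : ‖(∫ ω, (hc' t ω : ℂ) *
        Complex.exp (Complex.I * (∑ k ∈ Finset.range t, w t k * ε k ω : ℝ)) ∂P) -
        ∫ ω, (hc' s ω : ℂ) *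
        Complex.exp (Complex.I * (∑ k ∈ Finset.range t, w t k * ε k ω : ℝ)) ∂P‖ ≤ η :=
      (norm_integral_ofReal_mul_sub_le (hci t) (hci s) (hmE t _).aestronglyMeasurable
        (hbE t _)).trans (s1 t hst)
    have d2 : ‖(∫ ω, (hc' s ω : ℂ) *
        Complex.exp (Complex.I * (∑ k ∈ Finset.range t, w t k * ε k ω : ℝ)) ∂P) -
        ∫ ω, (hc' s ω : ℂ) *
        Complex.exp (Complex.I * (∑ k ∈ Finset.Ico s t, w t k * ε k ω : ℝ)) ∂P‖ ≤ η := by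
      refine (norm_integral_mul_sub_le (g := fun _ => η) (hci s).1 (hcb s)
        (Integrable.of_bound (hmE t _).aestronglyMeasurable 1 (hbE t _))
        (Integrable.of_bound (hmE t _).aestronglyMeasurable 1 (hbE t _))
        (integrable_const _) (ae_of_all _ fun ω => ?_)).trans (by simp)
      refine (norm_exp_I_mul_sub_exp_I_mul_le _ _).trans (le_trans ?_ t2)
      rw [Finset.sum_Ico_eq_sub _ hst, sub_sub_cancel]
      refine (Finset.abs_sum_le_sum_abs _ _).trans (Finset.sum_le_sum fun k _ => ?_)
      rw [abs_mul]
      exact mul_le_mul_of_nonneg_left (hε.bound k ω) (abs_nonneg _)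
    have d3 : ‖(∫ ω, (hc' s ω : ℂ) *
        Complex.exp (Complex.I * (∑ k ∈ Finset.Ico s t, w t k * ε k ω : ℝ)) ∂P) -
        ∫ ω, (hc' s ω : ℂ) * (Real.exp (-(Q / 2 * q s ω)) : ℝ) ∂P‖ ≤
        (c + 1) * (4 * B ^ 3 + B ^ 4 + 1) * η := by
      have := hε.norm_integral_sub_le (hcm s) (hcb s) (w t) hst 0 le_rfl
      simp only [zero_div, zero_mul, neg_zero, Real.exp_zero, Complex.ofReal_one, mul_one,
        zero_add] at this
      refine this.trans ?_
      have hterm : ∀ k ∈ Finset.Ico s t,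
          w t k ^ 2 * (4 * B ^ 3 * |w t k| + B ^ 4 * w t k ^ 2 + ∫ ω, |q k ω - q s ω| ∂P) ≤
          w t k ^ 2 * ((4 * B ^ 3 + B ^ 4 + 1) * η) := by
        intro k hk
        obtain ⟨k1, k2⟩ := Finset.mem_Ico.1 hk
        refine mul_le_mul_of_nonneg_left ?_ (sq_nonneg _)
        have u1 := t1 k k1 k2
        have u2 := s2 k k1
        have u3 : w t k ^ 2 ≤ η := by
          rw [← sq_abs]
          nlinarith [abs_nonneg (w t k)]
        have u4 := mul_le_mul_of_nonneg_left u1 (show 0 ≤ 4 * B ^ 3 by positivity)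
        have u5 := mul_le_mul_of_nonneg_left u3 (show 0 ≤ B ^ 4 by positivity)
        linarith
      refine (Finset.sum_le_sum hterm).trans ?_
      rw [← Finset.sum_mul, mul_assoc]
      exact mul_le_mul_of_nonneg_right hQ1 (by positivity)
    have d4 : ‖(∫ ω, (hc' s ω : ℂ) * (Real.exp (-(Q / 2 * q s ω)) : ℝ) ∂P) -
        ∫ ω, (hc' s ω : ℂ) * (Real.exp (-(c / 2 * q s ω)) : ℝ) ∂P‖ ≤ B ^ 2 * η := by
      refine (norm_integral_mul_sub_le (g := fun _ => B ^ 2 * η) (hci s).1 (hcb s)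
        (hiG s Q hQ0) (hiG s c hc) (integrable_const _) (ae_of_all _ fun ω => ?_)).trans
        (by simp)
      obtain ⟨q0, q1⟩ := hε.var_bound s ω
      rw [← Complex.ofReal_sub, Complex.norm_real]
      refine (abs_exp_neg_sub_exp_neg_le (by positivity) (by positivity)).trans ?_
      rw [← sub_mul, ← sub_div, abs_mul, abs_of_nonneg q0, abs_div, abs_of_pos (two_pos (α := ℝ))]
      have := mul_le_mul t3 q1 q0 hη.le
      have : 0 ≤ |Q - c| * q s ω := by positivity
      linarith
    -- Here `h` itself is back, by `e2`: the limit variance `V` need not be measurable at time `s`.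
    have d5 : ‖(∫ ω, (h ω : ℂ) * (Real.exp (-(c / 2 * q s ω)) : ℝ) ∂P) -
        ∫ ω, (h ω : ℂ) * (Real.exp (-(c / 2 * V ω)) : ℝ) ∂P‖ ≤ c * η := by
      refine (norm_integral_mul_sub_le (g := fun ω => c * |q s ω - V ω|) hh.aestronglyMeasurable
        (ae_of_all _ hhb) (hiG s c hc) hiV (((hε.integrable_var s).sub hV).abs.const_mul _)
        ?_).trans ?_
      · filter_upwards [hV0] with ω hω
        have q0 := (hε.var_bound s ω).1
        rw [← Complex.ofReal_sub, Complex.norm_real]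
        refine (abs_exp_neg_sub_exp_neg_le (by positivity) (by positivity)).trans ?_
        rw [← mul_sub, abs_mul, abs_of_nonneg (by positivity)]
        have : 0 ≤ c * |q s ω - V ω| := by positivity
        linarith
      · rw [integral_const_mul]
        exact mul_le_mul_of_nonneg_left s3 hc
    rw [e1]
    rw [← e2] at d4
    have := @norm_sub_le_norm_sub_add_norm_sub ℂ _
    calc _ ≤ η + (η + ((c + 1) * (4 * B ^ 3 + B ^ 4 + 1) * η + (B ^ 2 * η + c * η))) :=
          (this _ _ _).trans (add_le_add d1 ((this _ _ _).trans (add_le_add d2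
            ((this _ _ _).trans (add_le_add d3 ((this _ _ _).trans (add_le_add d4 d5)))))))
      _ = K * η := by rw [hK]; ring
  rw [tendsto_iff_norm_sub_tendsto_zero, Metric.tendsto_nhds]
  intro δ hδ
  have hη : 0 < min 1 (δ / (2 * K)) := lt_min one_pos (by positivity)
  filter_upwards [main _ hη (min_le_left _ _)] with t ht
  rw [Real.dist_eq, sub_zero, abs_norm]
  refine ht.trans_lt ?_
  calc K * min 1 (δ / (2 * K)) ≤ K * (δ / (2 * K)) := by gcongr; exact min_le_right _ _
    _ = δ / 2 := by field_simp
    _ < δ := by linarith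

/-- The characteristic function of a mixture is the mixture of the characteristic functions. The
`max` reflects the truncation of negative variances in `gaussianKernel`. -/
theorem charFun_bind_gaussianKernel (μ : Measure Ω) [IsProbabilityMeasure μ] (V : Ω → ℝ)
    (hV : Measurable V) (u : ℝ) :
    charFun (μ.bind (gaussianKernel V hV)) u =
      ∫ ω, ((Real.exp (-(u ^ 2 / 2 * max (V ω) 0)) : ℝ) : ℂ) ∂μ := by
  have h1 : charFun (μ.bind (gaussianKernel V hV)) u =
      ∫ ω, charFun (gaussianKernel V hV ω) u ∂μ := by
    simp only [charFun]
    have hi : Integrable (fun x : ℝ => Complex.exp (inner ℝ x u * Complex.I))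
        ((gaussianKernel V hV ∘ₖ Kernel.const Unit μ) ()) := by
      refine Integrable.of_bound (C := 1) ?_ (ae_of_all _ fun x => ?_)
      · exact Measurable.aestronglyMeasurable (by fun_prop)
      · exact (Complex.norm_exp_ofReal_mul_I _).le
    have := Kernel.integral_comp hi
    rwa [← Measure.comp_eq_comp_const_apply, Kernel.const_apply] at this
  rw [h1]
  refine integral_congr_ae (ae_of_all _ fun ω => ?_)
  have h2 : gaussianKernel V hV ω = gaussianReal 0 (V ω).toNNReal := rfl
  simp only [h2]
  rw [charFun_gaussianReal, Complex.ofReal_exp]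
  congr 1
  rw [Complex.ofReal_zero, mul_zero, zero_mul, zero_sub]
  have h3 : (((V ω).toNNReal : ℝ) : ℂ) = ((max (V ω) 0 : ℝ) : ℂ) := by rw [Real.coe_toNNReal']
  rw [h3]
  push_cast
  ring

theorem integral_cond_eq {H : Set Ω} (hH : MeasurableSet H) (F : Ω → ℂ) :
    ∫ ω, F ω ∂(P[|H]) =
      ((P H)⁻¹.toReal : ℂ) * ∫ ω, ((H.indicator (fun _ => (1 : ℝ)) ω : ℝ) : ℂ) * F ω ∂P := by
  rw [ProbabilityTheory.cond, integral_smul_measure, Complex.real_smul, ← integral_indicator hH]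
  congr 2
  ext ω
  by_cases hω : ω ∈ H <;> simp [hω]

/-- A criterion for stable convergence to a Gaussian kernel. -/
theorem convergesStably_gaussianKernel [IsProbabilityMeasure P] {Y : ℕ → Ω → ℝ}
    (hY : ∀ t, Measurable (Y t)) {V : Ω → ℝ} (hV : Measurable V) (hV0 : ∀ᵐ ω ∂P, 0 ≤ V ω)
    (h : ∀ (u : ℝ) (H : Set Ω), MeasurableSet H →
      Tendsto (fun t => ∫ ω, ((H.indicator (fun _ => (1 : ℝ)) ω : ℝ) : ℂ) *
          Complex.exp (Complex.I * (u * Y t ω : ℝ)) ∂P) atTop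
        (𝓝 (∫ ω, ((H.indicator (fun _ => (1 : ℝ)) ω : ℝ) : ℂ) *
          (Real.exp (-(u ^ 2 / 2 * V ω)) : ℝ) ∂P))) :
    ConvergesStably P Y (gaussianKernel V hV) := by
  refine ⟨hY, fun H hH hPH f => ?_⟩
  have : IsProbabilityMeasure (P[|H]) := cond_isProbabilityMeasure hPH.ne'
  have hp : ∀ t, IsProbabilityMeasure ((P[|H]).map (Y t)) := fun t =>
    Measure.isProbabilityMeasure_map (hY t).aemeasurable
  let μ : ℕ → ProbabilityMeasure ℝ := fun t => ⟨(P[|H]).map (Y t), hp t⟩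
  let ν : ProbabilityMeasure ℝ := ⟨(P[|H]).bind (gaussianKernel V hV), inferInstance⟩
  suffices Tendsto μ atTop (𝓝 ν) from
    (ProbabilityMeasure.tendsto_iff_forall_integral_tendsto.1 this) f
  refine ProbabilityMeasure.tendsto_of_tendsto_charFun fun u => ?_
  have e1 : ∀ t, charFun (μ t : Measure ℝ) u = ((P H)⁻¹.toReal : ℂ) *
      ∫ ω, ((H.indicator (fun _ => (1 : ℝ)) ω : ℝ) : ℂ) *
          Complex.exp (Complex.I * (u * Y t ω : ℝ)) ∂P := by
    intro t
    rw [← integral_cond_eq hH]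
    change charFun ((P[|H]).map (Y t)) u = _
    rw [charFun_apply_real, integral_map (hY t).aemeasurable
      (Measurable.aestronglyMeasurable (by fun_prop))]
    refine integral_congr_ae (ae_of_all _ fun ω => ?_)
    push_cast
    congr 1
    ring
  have e2 : charFun (ν : Measure ℝ) u = ((P H)⁻¹.toReal : ℂ) *
      ∫ ω, ((H.indicator (fun _ => (1 : ℝ)) ω : ℝ) : ℂ) *
          (Real.exp (-(u ^ 2 / 2 * V ω)) : ℝ) ∂P := by
    rw [← integral_cond_eq hH]
    change charFun ((P[|H]).bind (gaussianKernel V hV)) u = _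
    rw [charFun_bind_gaussianKernel]
    refine integral_congr_ae ?_
    filter_upwards [cond_absolutelyContinuous.ae_le hV0] with ω hω
    rw [max_eq_left hω]
  simp_rw [e1]
  rw [e2]
  exact (h u H hH).const_mul _

/-- **Stable central limit theorem** for weighted sums of bounded martingale differences. -/
theorem IsBoundedDifference.convergesStably [IsProbabilityMeasure P] {ℱ : Filtration ℕ m0}
    {B : ℝ} {ε q : ℕ → Ω → ℝ} (hε : IsBoundedDifference P ℱ B ε q)
    {w : ℕ → ℕ → ℝ} {c : ℝ}
    (hsum : Tendsto (fun t => ∑ k ∈ Finset.range t, w t k ^ 2) atTop (𝓝 c))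
    (hfix : ∀ k, Tendsto (fun t => w t k) atTop (𝓝 0))
    (hsmall : ∀ η : ℝ, 0 < η → ∀ᶠ s in atTop, ∀ᶠ t in atTop, ∀ k, s ≤ k → k < t → |w t k| ≤ η)
    {V₀ : Ω → ℝ} (hV₀ : Integrable V₀ P) (hV0 : ∀ᵐ ω ∂P, 0 ≤ V₀ ω)
    (hqV : Tendsto (fun s => ∫ ω, |q s ω - V₀ ω| ∂P) atTop (𝓝 0))
    {V : Ω → ℝ} (hV : Measurable V) (hVc : ∀ᵐ ω ∂P, V ω = c * V₀ ω) :
    ConvergesStably P (fun t ω => ∑ k ∈ Finset.range t, w t k * ε k ω)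
      (gaussianKernel V hV) := by
  have hc : 0 ≤ c := ge_of_tendsto' hsum fun t => Finset.sum_nonneg fun _ _ => sq_nonneg _
  refine convergesStably_gaussianKernel
    (fun t => Finset.measurable_fun_sum _ fun k _ => (hε.measurable k).const_mul _) hV ?_ ?_
  · filter_upwards [hV0, hVc] with ω h1 h2
    rw [h2]
    positivity
  · intro u H hH
    have hsum' : Tendsto (fun t => ∑ k ∈ Finset.range t, (u * w t k) ^ 2) atTop
        (𝓝 (u ^ 2 * c)) := by
      refine (hsum.const_mul (u ^ 2)).congr fun t => ?_
      simp_rw [mul_pow, Finset.mul_sum]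
    have hfix' : ∀ k, Tendsto (fun t => u * w t k) atTop (𝓝 0) := fun k => by
      simpa using (hfix k).const_mul u
    have hsmall' : ∀ η : ℝ, 0 < η → ∀ᶠ s in atTop, ∀ᶠ t in atTop, ∀ k, s ≤ k → k < t →
        |u * w t k| ≤ η := by
      intro η hη
      filter_upwards [hsmall (η / (|u| + 1)) (by positivity)] with s hs
      filter_upwards [hs] with t ht k h1 h2
      have h3 := ht k h1 h2
      rw [le_div_iff₀ (by positivity)] at h3
      rw [abs_mul]
      nlinarith [abs_nonneg (w t k)]
    -- The argument `u` of the characteristic function is absorbed into the weights.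
    have key := hε.tendsto_integral_exp (w := fun t k => u * w t k) hsum' hfix' hsmall' hV₀ hV0 hqV
      (h := H.indicator fun _ => (1 : ℝ)) (measurable_const.indicator hH) (fun ω => by
        by_cases hω : ω ∈ H <;> simp [hω])
    have e1 : ∫ ω, ((H.indicator (fun _ => (1 : ℝ)) ω : ℝ) : ℂ) *
          (Real.exp (-(u ^ 2 / 2 * V ω)) : ℝ) ∂P =
        ∫ ω, ((H.indicator (fun _ => (1 : ℝ)) ω : ℝ) : ℂ) *
          (Real.exp (-(u ^ 2 * c / 2 * V₀ ω)) : ℝ) ∂P := by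
      refine integral_congr_ae ?_
      filter_upwards [hVc] with ω hω
      rw [hω]
      congr 4
      ring
    rw [e1]
    refine key.congr fun t => ?_
    simp_rw [Finset.mul_sum, mul_assoc]

end StableLimit

/-! ### Elementary properties of the urn system -/

section Urn

variable {Ω : Type*} {N : ℕ}

/-- The conditional probability, given the history, that the next ball added to urn `i` is red. -/
def redProb (a b : ℕ) (α : ℝ) (red : ℕ → Fin N → Set Ω) (t : ℕ) (i : Fin N) (ω : Ω) : ℝ :=
  α * totalFraction a b red t ω + (1 - α) * urnFraction a b red t i ω

/-- The centred colour of the ball added to urn `i` at time `t + 1`. -/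
def innovation (a b : ℕ) (α : ℝ) (red : ℕ → Fin N → Set Ω) (t : ℕ) (i : Fin N) (ω : Ω) : ℝ :=
  (red (t + 1) i).indicator (fun _ => (1 : ℝ)) ω - redProb a b α red t i ω

/-- A linear combination over the urns of the centred colours. -/
def noise (a b : ℕ) (α : ℝ) (red : ℕ → Fin N → Set Ω) (c : Fin N → ℝ) (t : ℕ) (ω : Ω) : ℝ :=
  ∑ i, c i * innovation a b α red t i ω

/-- The conditional variance of `noise`. -/
def noiseVar (a b : ℕ) (α : ℝ) (red : ℕ → Fin N → Set Ω) (c : Fin N → ℝ) (t : ℕ) (ω : Ω) : ℝ :=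
  ∑ i, c i ^ 2 * (redProb a b α red t i ω * (1 - redProb a b α red t i ω))

variable {a b : ℕ} {α : ℝ} {red : ℕ → Fin N → Set Ω}

theorem urnFraction_succ (ha : 1 ≤ a) (t : ℕ) (i : Fin N) (ω : Ω) :
    ((a : ℝ) + b + t + 1) * urnFraction a b red (t + 1) i ω =
      ((a : ℝ) + b + t) * urnFraction a b red t i ω +
        (red (t + 1) i).indicator (fun _ => (1 : ℝ)) ω := by
  have h1 : (0 : ℝ) < a := by exact_mod_cast ha
  have h2 : (a : ℝ) + b + t ≠ 0 := by positivity
  have h3 : (a : ℝ) + b + t + 1 ≠ 0 := by positivity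
  rw [urnFraction, urnFraction, mul_div_cancel₀ _ h2]
  push_cast
  rw [← add_assoc ((a : ℝ) + b), mul_div_cancel₀ _ h3, redBalls, redBalls,
    Finset.sum_Icc_succ_top (by lia), add_assoc]

theorem urnFraction_zero (i : Fin N) (ω : Ω) :
    urnFraction a b red 0 i ω = (a : ℝ) / ((a : ℝ) + b) := by
  simp [urnFraction, redBalls]

theorem totalFraction_zero (hN : 1 < N) (ω : Ω) :
    totalFraction a b red 0 ω = (a : ℝ) / ((a : ℝ) + b) := by
  have : (N : ℝ) ≠ 0 := by positivity
  simp only [totalFraction, urnFraction_zero, Finset.sum_const, Finset.card_univ, Fintype.card_fin,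
    nsmul_eq_mul]
  field_simp

theorem urnFraction_nonneg (t : ℕ) (i : Fin N) (ω : Ω) : 0 ≤ urnFraction a b red t i ω :=
  div_nonneg (add_nonneg (Nat.cast_nonneg _) (Finset.sum_nonneg fun k _ =>
    Set.indicator_nonneg (fun _ _ => zero_le_one) _)) (by positivity)

theorem urnFraction_le_one (t : ℕ) (i : Fin N) (ω : Ω) : urnFraction a b red t i ω ≤ 1 := by
  refine div_le_one_of_le₀ ?_ (by positivity)
  have : ∑ k ∈ Finset.Icc 1 t, (red k i).indicator (fun _ => (1 : ℝ)) ω ≤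
      ∑ k ∈ Finset.Icc 1 t, (1 : ℝ) :=
    Finset.sum_le_sum fun k _ => Set.indicator_le_self' (fun _ _ => zero_le_one) ω
  simp only [Finset.sum_const, Nat.card_Icc, nsmul_eq_mul, mul_one, Nat.add_sub_cancel] at this
  have hb : (0 : ℝ) ≤ b := Nat.cast_nonneg _
  rw [redBalls]
  linarith

theorem sum_urnFraction (hN : 1 < N) (t : ℕ) (ω : Ω) :
    ∑ i, urnFraction a b red t i ω = N * totalFraction a b red t ω := by
  have : (N : ℝ) ≠ 0 := by positivity
  rw [totalFraction]
  field_simp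

theorem totalFraction_nonneg (t : ℕ) (ω : Ω) : 0 ≤ totalFraction a b red t ω :=
  mul_nonneg (by positivity) (Finset.sum_nonneg fun i _ => urnFraction_nonneg t i ω)

theorem totalFraction_le_one (hN : 1 < N) (t : ℕ) (ω : Ω) : totalFraction a b red t ω ≤ 1 := by
  have h0 : (0 : ℝ) < N := by positivity
  have h1 : ∑ i, urnFraction a b red t i ω ≤ ∑ _i : Fin N, (1 : ℝ) :=
    Finset.sum_le_sum fun i _ => urnFraction_le_one t i ω
  rw [sum_urnFraction hN] at h1
  simp only [Finset.sum_const, Finset.card_univ, Fintype.card_fin, nsmul_eq_mul] at h1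
  exact le_of_mul_le_mul_left h1 h0

theorem redProb_nonneg (h₀ : 1 / 2 ≤ α) (h₁ : α ≤ 1) (t : ℕ) (i : Fin N) (ω : Ω) :
    0 ≤ redProb a b α red t i ω :=
  add_nonneg (mul_nonneg (by linarith) (totalFraction_nonneg t ω))
    (mul_nonneg (by linarith) (urnFraction_nonneg t i ω))

theorem redProb_le_one (hN : 1 < N) (h₀ : 1 / 2 ≤ α) (h₁ : α ≤ 1) (t : ℕ) (i : Fin N) (ω : Ω) :
    redProb a b α red t i ω ≤ 1 := by
  have h2 := totalFraction_le_one (a := a) (b := b) (red := red) hN t ω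
  have h3 := urnFraction_le_one (a := a) (b := b) (red := red) t i ω
  rw [redProb]
  nlinarith

theorem sum_redProb (hN : 1 < N) (t : ℕ) (ω : Ω) :
    ∑ i, redProb a b α red t i ω = N * totalFraction a b red t ω := by
  simp only [redProb, Finset.sum_add_distrib, ← Finset.mul_sum, sum_urnFraction hN,
    Finset.sum_const, Finset.card_univ, Fintype.card_fin, nsmul_eq_mul]
  ring

theorem abs_innovation_le (hN : 1 < N) (h₀ : 1 / 2 ≤ α) (h₁ : α ≤ 1) (t : ℕ) (i : Fin N) (ω : Ω) :
    |innovation a b α red t i ω| ≤ 1 := by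
  have h2 := redProb_nonneg (a := a) (b := b) (red := red) h₀ h₁ t i ω
  have h3 := redProb_le_one (a := a) (b := b) (red := red) hN h₀ h₁ t i ω
  rw [innovation, abs_le]
  by_cases h : ω ∈ red (t + 1) i <;> simp [h] <;> constructor <;> linarith

/-- The coefficients of the noise driving the difference of urn `j` and the mean of the urns. -/
def diffCoeff (j i : Fin N) : ℝ := (if i = j then 1 else 0) - 1 / (N : ℝ)

theorem sum_abs_diffCoeff_le (hN : 1 < N) (j : Fin N) : ∑ i, |diffCoeff j i| ≤ 2 := by
  have h0 : (N : ℝ) ≠ 0 := by positivity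
  calc ∑ i, |diffCoeff j i| ≤ ∑ i : Fin N, ((if i = j then 1 else 0) + 1 / (N : ℝ)) := by
        refine Finset.sum_le_sum fun i _ => (abs_sub _ _).trans (le_of_eq ?_)
        rw [abs_of_nonneg (a := 1 / (N : ℝ)) (by positivity)]
        split_ifs <;> simp
    _ = 2 := by
        rw [Finset.sum_add_distrib]
        simp [h0]
        norm_num

/-- The source of the factor `1 - 1/N` in the limiting variance. -/
theorem sum_diffCoeff_sq (hN : 1 < N) (j : Fin N) :
    ∑ i, diffCoeff j i ^ 2 = 1 - 1 / (N : ℝ) := by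
  have h0 : (N : ℝ) ≠ 0 := by positivity
  have : ∀ i, diffCoeff j i ^ 2 =
      (if i = j then (1 - 2 / (N : ℝ)) else 0) + 1 / (N : ℝ) ^ 2 := by
    intro i
    rw [diffCoeff]
    split_ifs <;> ring
  simp only [this, Finset.sum_add_distrib, Finset.sum_ite_eq', Finset.mem_univ, if_true,
    Finset.sum_const, Finset.card_univ, Fintype.card_fin, nsmul_eq_mul]
  field_simp
  ring

theorem noise_diffCoeff (j : Fin N) (t : ℕ) (ω : Ω) :
    noise a b α red (diffCoeff j) t ω =
      innovation a b α red t j ω - 1 / (N : ℝ) * ∑ i, innovation a b α red t i ω := by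
  simp only [noise, diffCoeff, sub_mul, Finset.sum_sub_distrib, ite_mul, one_mul, zero_mul,
    Finset.sum_ite_eq', Finset.mem_univ, if_true, Finset.mul_sum]

theorem sum_innovation (hN : 1 < N) (t : ℕ) (ω : Ω) :
    ∑ i, innovation a b α red t i ω =
      ∑ i, (red (t + 1) i).indicator (fun _ => (1 : ℝ)) ω - N * totalFraction a b red t ω := by
  simp only [innovation, Finset.sum_sub_distrib, sum_redProb hN]

/-- The redness probabilities average to the total fraction for every `α`, so no drift remains. -/
theorem totalFraction_succ (hN : 1 < N) (ha : 1 ≤ a) (t : ℕ) (ω : Ω) :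
    totalFraction a b red (t + 1) ω = totalFraction a b red t ω +
      noise a b α red (fun _ => 1 / (N : ℝ)) t ω / ((a : ℝ) + b + t + 1) := by
  have h0 : (N : ℝ) ≠ 0 := by positivity
  have h3 : (a : ℝ) + b + t + 1 ≠ 0 := by positivity
  have h4 := Finset.sum_congr (rfl : (Finset.univ : Finset (Fin N)) = Finset.univ)
    fun i _ => urnFraction_succ (b := b) (red := red) ha t i ω
  rw [Finset.sum_add_distrib, ← Finset.mul_sum, ← Finset.mul_sum, sum_urnFraction hN,
    sum_urnFraction hN] at h4
  rw [noise, ← Finset.mul_sum, sum_innovation hN]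
  field_simp
  linarith

theorem diff_succ (hN : 1 < N) (ha : 1 ≤ a) (t : ℕ) (j : Fin N) (ω : Ω) :
    urnFraction a b red (t + 1) j ω - totalFraction a b red (t + 1) ω =
      (1 - α / ((a : ℝ) + b + t + 1)) *
        (urnFraction a b red t j ω - totalFraction a b red t ω) +
      noise a b α red (diffCoeff j) t ω / ((a : ℝ) + b + t + 1) := by
  have h3 : (a : ℝ) + b + t + 1 ≠ 0 := by positivity
  have h4 := urnFraction_succ (b := b) (red := red) ha t j ω
  have h5 : urnFraction a b red (t + 1) j ω = (((a : ℝ) + b + t) * urnFraction a b red t j ω +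
        (red (t + 1) j).indicator (fun _ => (1 : ℝ)) ω) / ((a : ℝ) + b + t + 1) := by
    rw [eq_div_iff h3, mul_comm, h4]
  rw [h5, totalFraction_succ (α := α) hN ha, noise_diffCoeff, noise, ← Finset.mul_sum, innovation,
    redProb]
  field_simp
  ring

/-- The linear recursion is unrolled. There is no initial term because all urns start with the same
composition, and the noise of index `k` enters at time `k + 1`, so it is contracted only from then
on. -/
theorem diff_eq_sum (hN : 1 < N) (ha : 1 ≤ a) (t : ℕ) (j : Fin N) (ω : Ω) :
    urnFraction a b red t j ω - totalFraction a b red t ω =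
      ∑ k ∈ Finset.range t, contraction (a + b) α (k + 1) t / (((a + b : ℕ) : ℝ) + k + 1) *
        noise a b α red (diffCoeff j) k ω := by
  induction t with
  | zero => rw [urnFraction_zero, totalFraction_zero hN, sub_self, Finset.range_zero,
      Finset.sum_empty]
  | succ t ih =>
    rw [diff_succ (α := α) hN ha, ih, Finset.sum_range_succ, contraction_self, Finset.mul_sum]
    push_cast
    congr 1
    · refine Finset.sum_congr rfl fun k hk => ?_
      rw [contraction_succ _ _ (Finset.mem_range.1 hk)]
      push_cast
      ring
    · ring

theorem noiseVar_bounds (hN : 1 < N) (h₀ : 1 / 2 ≤ α) (h₁ : α ≤ 1) {c : Fin N → ℝ} {B : ℝ}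
    (hc : ∑ i, |c i| ≤ B) (t : ℕ) (ω : Ω) :
    0 ≤ noiseVar a b α red c t ω ∧ noiseVar a b α red c t ω ≤ B ^ 2 := by
  have hp := fun i => redProb_nonneg (a := a) (b := b) (red := red) h₀ h₁ t i ω
  have hp' := fun i => redProb_le_one (a := a) (b := b) (red := red) hN h₀ h₁ t i ω
  refine ⟨Finset.sum_nonneg fun i _ => mul_nonneg (sq_nonneg _)
    (mul_nonneg (hp i) (by linarith [hp' i])), ?_⟩
  have hB : 0 ≤ B := (Finset.sum_nonneg fun i _ => abs_nonneg (c i)).trans hc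
  have h : ∀ i ∈ Finset.univ,
      c i ^ 2 * (redProb a b α red t i ω * (1 - redProb a b α red t i ω)) ≤ B * |c i| := by
    intro i hi
    have h1 : |c i| ≤ B :=
      (Finset.single_le_sum (f := fun i => |c i|) (fun i _ => abs_nonneg (c i)) hi).trans hc
    have h2 : redProb a b α red t i ω * (1 - redProb a b α red t i ω) ≤ 1 :=
      mul_le_one₀ (hp' i) (by linarith [hp' i]) (by linarith [hp i])
    have h3 := mul_le_mul_of_nonneg_left h2 (sq_nonneg (c i))
    have h4 := mul_le_mul_of_nonneg_right h1 (abs_nonneg (c i))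
    have h5 := abs_mul_abs_self (c i)
    nlinarith
  refine (Finset.sum_le_sum h).trans ?_
  rw [← Finset.mul_sum, sq]
  exact mul_le_mul_of_nonneg_left hc hB

theorem measurableSet_history {k t : ℕ} (h1 : 1 ≤ k) (h2 : k ≤ t) (i : Fin N) :
    MeasurableSet[history red t] (red k i) :=
  MeasurableSpace.measurableSet_generateFrom ⟨k, i, h1, h2, rfl⟩

theorem measurable_indicator_red {k t : ℕ} (h1 : 1 ≤ k) (h2 : k ≤ t) (i : Fin N) :
    Measurable[history red t] ((red k i).indicator fun _ => (1 : ℝ)) :=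
  Measurable.indicator measurable_const (measurableSet_history h1 h2 i)

theorem measurable_urnFraction (t : ℕ) (i : Fin N) :
    Measurable[history red t] (urnFraction a b red t i) := by
  refine Measurable.div_const ?_ _
  refine Measurable.const_add ?_ _
  exact Finset.measurable_fun_sum _ fun k hk =>
    measurable_indicator_red (Finset.mem_Icc.1 hk).1 (Finset.mem_Icc.1 hk).2 i

theorem measurable_totalFraction (t : ℕ) :
    Measurable[history red t] (totalFraction a b red t) :=
  Measurable.const_mul (Finset.measurable_fun_sum _ fun i _ => measurable_urnFraction t i) _

theorem measurable_redProb (t : ℕ) (i : Fin N) :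
    Measurable[history red t] (redProb a b α red t i) :=
  ((measurable_totalFraction t).const_mul _).add ((measurable_urnFraction t i).const_mul _)

theorem measurable_innovation (t : ℕ) (i : Fin N) :
    Measurable[history red (t + 1)] (innovation a b α red t i) :=
  (measurable_indicator_red (by lia) le_rfl i).sub ((measurable_redProb t i).mono
    (MeasurableSpace.generateFrom_mono fun _ ⟨k, i, h1, h2, h3⟩ =>
      ⟨k, i, h1, h2.trans (Nat.le_succ t), h3⟩) le_rfl)

end Urn

/-! ### The conditional law of the colours -/

section System

variable {Ω : Type*} [m0 : MeasurableSpace Ω] {P : Measure Ω} {N a b : ℕ} {α : ℝ}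
  {red : ℕ → Fin N → Set Ω}

/-- The filtration generated by the colours of the balls. -/
def historyFiltration (hred : IsUrnSystem P a b α red) : Filtration ℕ m0 where
  seq := history red
  mono' s t hst := MeasurableSpace.generateFrom_mono fun _ ⟨k, i, h1, h2, h3⟩ =>
    ⟨k, i, h1, h2.trans hst, h3⟩
  le' t := MeasurableSpace.generateFrom_le fun s ⟨k, i, h1, _, h3⟩ => by
    -- The history starts at index 1, and `red 0` is not assumed measurable.
    obtain ⟨k, rfl⟩ : ∃ l, k = l + 1 := ⟨k - 1, by lia⟩
    exact h3 ▸ hred.measurableSet_red k i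

/-- An indicator is idempotent on the diagonal; off it, conditional independence of pairs suffices,
since only second moments are needed. -/
theorem condExp_indicator_mul (hred : IsUrnSystem P a b α red) (t : ℕ) (i k : Fin N) :
    P[(red (t + 1) i).indicator (fun _ => (1 : ℝ)) * (red (t + 1) k).indicator (fun _ => (1 : ℝ))|
      historyFiltration hred t] =ᵐ[P]
    if i = k then redProb a b α red t i else redProb a b α red t i * redProb a b α red t k := by
  have hmul : (red (t + 1) i).indicator (fun _ => (1 : ℝ)) *
      (red (t + 1) k).indicator (fun _ => (1 : ℝ)) =
      (red (t + 1) i ∩ red (t + 1) k).indicator fun _ => (1 : ℝ) := by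
    ext ω
    by_cases h1 : ω ∈ red (t + 1) i <;> by_cases h2 : ω ∈ red (t + 1) k <;> simp [h1, h2]
  rw [hmul]
  split_ifs with h
  · subst h
    rw [Set.inter_self]
    exact hred.condProb_red t i
  · have h1 := hred.condIndep_red t {i, k}
    have h2 : ⋂ l ∈ ({i, k} : Finset (Fin N)), red (t + 1) l = red (t + 1) i ∩ red (t + 1) k := by
      simp [Finset.mem_insert, Set.iInter_iInter_eq_or_left]
    rw [h2, Finset.prod_pair h] at h1
    refine h1.trans ?_
    filter_upwards [hred.condProb_red t i, hred.condProb_red t k] with ω e1 e2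
    rw [Pi.mul_apply, e1, e2]
    rfl

variable [IsProbabilityMeasure P]

theorem condExp_innovation (hN : 1 < N) (h₀ : 1 / 2 ≤ α) (h₁ : α ≤ 1)
    (hred : IsUrnSystem P a b α red) (t : ℕ) (i : Fin N) :
    P[innovation a b α red t i|historyFiltration hred t] =ᵐ[P] 0 := by
  have hm := (historyFiltration hred).le t
  have hp : StronglyMeasurable[historyFiltration hred t] (redProb a b α red t i) :=
    (measurable_redProb t i).stronglyMeasurable
  have hpi : Integrable (redProb a b α red t i) P :=
    Integrable.of_bound (hp.mono hm).aestronglyMeasurable 1 (ae_of_all _ fun ω => by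
      rw [Real.norm_eq_abs, abs_of_nonneg (redProb_nonneg h₀ h₁ t i ω)]
      exact redProb_le_one hN h₀ h₁ t i ω)
  have hxi : Integrable ((red (t + 1) i).indicator fun _ => (1 : ℝ)) P :=
    (integrable_const _).indicator (hred.measurableSet_red t i)
  have h1 := condExp_sub hxi hpi (historyFiltration hred t)
  rw [condExp_of_stronglyMeasurable hm hp hpi] at h1
  have h2 : innovation a b α red t i =
    (red (t + 1) i).indicator (fun _ => (1 : ℝ)) - redProb a b α red t i := rfl
  rw [h2]
  filter_upwards [h1, hred.condProb_red t i] with ω e1 e2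
  rw [e1, Pi.sub_apply]
  change (P⟦red (t + 1) i|history red t⟧) ω - _ = _
  rw [e2]
  simp [redProb]

theorem condExp_innovation_mul (hN : 1 < N) (h₀ : 1 / 2 ≤ α) (h₁ : α ≤ 1)
    (hred : IsUrnSystem P a b α red) (t : ℕ) (i k : Fin N) :
    P[innovation a b α red t i * innovation a b α red t k|historyFiltration hred t] =ᵐ[P]
      fun ω => if i = k then redProb a b α red t i ω * (1 - redProb a b α red t i ω) else 0 := by
  have hm := (historyFiltration hred).le t
  have hp : ∀ i, StronglyMeasurable[historyFiltration hred t] (redProb a b α red t i) :=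
    fun i => (measurable_redProb t i).stronglyMeasurable
  have hpb : ∀ i, ∀ᵐ ω ∂P, ‖redProb a b α red t i ω‖ ≤ 1 := fun i => ae_of_all _ fun ω => by
    rw [Real.norm_eq_abs, abs_of_nonneg (redProb_nonneg h₀ h₁ t i ω)]
    exact redProb_le_one hN h₀ h₁ t i ω
  have hpm := fun i => ((hp i).mono hm).aestronglyMeasurable (μ := P)
  have hηi : ∀ i, Integrable (innovation a b α red t i) P := fun i =>
    Integrable.of_bound (((measurable_innovation t i).mono
      ((historyFiltration hred).le (t + 1)) le_rfl).aestronglyMeasurable) 1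
      (ae_of_all _ fun ω => abs_innovation_le hN h₀ h₁ t i ω)
  have hxi : Integrable ((red (t + 1) i).indicator (fun _ => (1 : ℝ)) *
      (red (t + 1) k).indicator (fun _ => (1 : ℝ))) P := by
    refine Integrable.of_bound ?_ 1 (ae_of_all _ fun ω => ?_)
    · exact ((measurable_const.indicator (hred.measurableSet_red t i)).mul
        (measurable_const.indicator (hred.measurableSet_red t k))).aestronglyMeasurable
    · rw [Pi.mul_apply]
      by_cases h1 : ω ∈ red (t + 1) i <;> by_cases h2 : ω ∈ red (t + 1) k <;> simp [h1, h2]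
  have i1 : ∀ i k, Integrable (redProb a b α red t i * innovation a b α red t k) P := fun i k =>
    (hηi k).bdd_mul (hpm i) (hpb i)
  have i2 : Integrable (redProb a b α red t i * redProb a b α red t k) P :=
    Integrable.bdd_mul (Integrable.of_bound (hpm k) 1 (hpb k)) (hpm i) (hpb i)
  -- Written so that the two middle terms, a known factor times a centred innovation, vanish under
  -- conditioning.
  have e : innovation a b α red t i * innovation a b α red t k =
      ((((red (t + 1) i).indicator (fun _ => (1 : ℝ)) *
        (red (t + 1) k).indicator (fun _ => (1 : ℝ))) -
      redProb a b α red t i * innovation a b α red t k) -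
      redProb a b α red t k * innovation a b α red t i) -
      redProb a b α red t i * redProb a b α red t k := by
    ext ω
    simp only [Pi.mul_apply, Pi.sub_apply, innovation]
    ring
  rw [e]
  have c1 := condExp_sub ((hxi.sub (i1 i k)).sub (i1 k i)) i2 (historyFiltration hred t)
  have c2 := condExp_sub (hxi.sub (i1 i k)) (i1 k i) (historyFiltration hred t)
  have c3 := condExp_sub hxi (i1 i k) (historyFiltration hred t)
  rw [condExp_of_stronglyMeasurable hm ((hp i).mul (hp k)) i2] at c1
  have c4 := condExp_mul_of_stronglyMeasurable_left (hp i) (i1 i k) (hηi k)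
  have c5 := condExp_mul_of_stronglyMeasurable_left (hp k) (i1 k i) (hηi i)
  filter_upwards [c1, c2, c3, c4, c5, condExp_indicator_mul hred t i k,
    condExp_innovation hN h₀ h₁ hred t i, condExp_innovation hN h₀ h₁ hred t k]
    with ω d1 d2 d3 d4 d5 d6 d7 d8
  rw [d1, Pi.sub_apply, d2, Pi.sub_apply, d3, Pi.sub_apply, d4, d5, d6, Pi.mul_apply, Pi.mul_apply,
    d7, d8]
  split_ifs with h
  · subst h
    simp
    ring
  · simp

/-- Linear combinations of the centred colours are bounded martingale differences. -/
theorem isBoundedDifference_noise (hN : 1 < N) (h₀ : 1 / 2 ≤ α) (h₁ : α ≤ 1)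
    (hred : IsUrnSystem P a b α red) {c : Fin N → ℝ} {B : ℝ} (hc : ∑ i, |c i| ≤ B) :
    IsBoundedDifference P (historyFiltration hred) B (noise a b α red c)
      (noiseVar a b α red c) where
  meas t := (Finset.measurable_fun_sum _ fun i _ =>
    (measurable_innovation t i).const_mul _).stronglyMeasurable
  bound t ω := by
    refine (Finset.abs_sum_le_sum_abs _ _).trans (le_trans (Finset.sum_le_sum fun i _ => ?_) hc)
    rw [abs_mul]
    exact mul_le_of_le_one_right (abs_nonneg _) (abs_innovation_le hN h₀ h₁ t i ω)
  condExp_eq_zero t := by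
    have hηi : ∀ i, Integrable (innovation a b α red t i) P := fun i =>
      Integrable.of_bound (((measurable_innovation t i).mono
        ((historyFiltration hred).le (t + 1)) le_rfl).aestronglyMeasurable) 1
        (ae_of_all _ fun ω => abs_innovation_le hN h₀ h₁ t i ω)
    have e : noise a b α red c t = ∑ i, c i • innovation a b α red t i := by
      ext ω
      simp [noise]
    rw [e]
    have h1 := condExp_finsetSum (μ := P) (s := Finset.univ)
      (fun i _ => (hηi i).smul (c i)) (historyFiltration hred t)
    have h2 : ∀ᵐ ω ∂P, ∀ i, (P[c i • innovation a b α red t i|historyFiltration hred t]) ω = 0 := by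
      refine ae_all_iff.2 fun i => ?_
      filter_upwards [condExp_smul (μ := P) (c i) (innovation a b α red t i)
        (historyFiltration hred t), condExp_innovation hN h₀ h₁ hred t i] with ω e1 e2
      rw [e1, Pi.smul_apply, e2]
      simp
    filter_upwards [h1, h2] with ω e1 e2
    rw [e1, Finset.sum_apply]
    exact Finset.sum_eq_zero fun i _ => e2 i
  meas_var t := (Finset.measurable_fun_sum _ fun i _ => Measurable.const_mul
    ((measurable_redProb t i).mul ((measurable_redProb t i).const_sub 1)) _).stronglyMeasurable
  var_bound t ω := noiseVar_bounds hN h₀ h₁ hc t ω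
  condExp_sq t := by
    have hηm : ∀ i, Measurable (innovation a b α red t i) := fun i =>
      (measurable_innovation t i).mono ((historyFiltration hred).le (t + 1)) le_rfl
    have hηi : ∀ i k, Integrable (innovation a b α red t i * innovation a b α red t k) P :=
      fun i k => Integrable.of_bound ((hηm i).mul (hηm k)).aestronglyMeasurable 1
        (ae_of_all _ fun ω => by
          rw [Pi.mul_apply, norm_mul]
          exact mul_le_one₀ (abs_innovation_le hN h₀ h₁ t i ω) (norm_nonneg _)
            (abs_innovation_le hN h₀ h₁ t k ω))
    have e : noise a b α red c t ^ 2 = ∑ x : Fin N × Fin N, (c x.1 * c x.2) •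
        (innovation a b α red t x.1 * innovation a b α red t x.2) := by
      ext ω
      simp only [Pi.pow_apply, noise, Finset.sum_apply, Pi.smul_apply, Pi.mul_apply, smul_eq_mul]
      rw [sq, Finset.sum_mul_sum, Fintype.sum_prod_type]
      refine Finset.sum_congr rfl fun i _ => Finset.sum_congr rfl fun k _ => by ring
    rw [e]
    have h1 := condExp_finsetSum (μ := P) (s := Finset.univ)
      (fun (x : Fin N × Fin N) _ => (hηi x.1 x.2).smul (c x.1 * c x.2)) (historyFiltration hred t)
    have h2 : ∀ᵐ ω ∂P, ∀ x : Fin N × Fin N, (P[(c x.1 * c x.2) •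
        (innovation a b α red t x.1 * innovation a b α red t x.2)|historyFiltration hred t]) ω =
        c x.1 * c x.2 * if x.1 = x.2 then
          redProb a b α red t x.1 ω * (1 - redProb a b α red t x.1 ω) else 0 := by
      refine ae_all_iff.2 fun x => ?_
      filter_upwards [condExp_smul (μ := P) (c x.1 * c x.2)
        (innovation a b α red t x.1 * innovation a b α red t x.2) (historyFiltration hred t),
        condExp_innovation_mul hN h₀ h₁ hred t x.1 x.2] with ω e1 e2
      rw [e1, Pi.smul_apply, e2, smul_eq_mul]
    filter_upwards [h1, h2] with ω e1 e2
    rw [e1, Finset.sum_apply]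
    simp only [e2, noiseVar]
    rw [Fintype.sum_prod_type]
    refine Finset.sum_congr rfl fun i _ => ?_
    simp only [mul_ite, mul_zero, Finset.sum_ite_eq, Finset.mem_univ, if_true]
    ring

end System

/-! ### Moments of martingale differences -/

section Moments

variable {Ω : Type*} {m0 : MeasurableSpace Ω} {P : Measure Ω} [IsProbabilityMeasure P]
  {ℱ : Filtration ℕ m0} {B : ℝ} {ε q : ℕ → Ω → ℝ}

theorem IsBoundedDifference.integrable (hε : IsBoundedDifference P ℱ B ε q) (k : ℕ) :
    Integrable (ε k) P :=
  Integrable.of_bound (hε.measurable k).aestronglyMeasurable B (ae_of_all _ (hε.bound k))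

theorem IsBoundedDifference.integrable_sq (hε : IsBoundedDifference P ℱ B ε q) (k : ℕ) :
    Integrable (fun ω => ε k ω ^ 2) P :=
  Integrable.of_bound ((hε.measurable k).pow_const 2).aestronglyMeasurable (B ^ 2)
    (ae_of_all _ fun ω => by
      rw [Real.norm_eq_abs, abs_pow]
      exact pow_le_pow_left₀ (abs_nonneg _) (hε.bound k ω) 2)

theorem IsBoundedDifference.integral_sq (hε : IsBoundedDifference P ℱ B ε q) (k : ℕ) :
    ∫ ω, ε k ω ^ 2 ∂P = ∫ ω, q k ω ∂P := by
  rw [← integral_congr_ae (hε.condExp_sq k), integral_condExp (ℱ.le k)]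
  rfl

theorem IsBoundedDifference.integral_mul_eq_zero (hε : IsBoundedDifference P ℱ B ε q) {k : ℕ}
    {G : Ω → ℝ} (hG : StronglyMeasurable[ℱ k] G) (hGb : ∀ ω, |G ω| ≤ 1) :
    ∫ ω, G ω * ε k ω ∂P = 0 := by
  have hi : Integrable (G * ε k) P :=
    (hε.integrable k).bdd_mul (hG.mono (ℱ.le k)).aestronglyMeasurable (ae_of_all _ hGb)
  have h1 := condExp_mul_of_stronglyMeasurable_left hG hi (hε.integrable k)
  change ∫ ω, (G * ε k) ω ∂P = 0
  rw [← integral_condExp (ℱ.le k), integral_congr_ae h1, ← integral_zero Ω ℝ]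
  refine integral_congr_ae ?_
  filter_upwards [hε.condExp_eq_zero k] with ω hω
  simp [hω]

/-- The second moment of a bounded process after one step driven by a martingale difference. -/
theorem IsBoundedDifference.integral_add_sq (hε : IsBoundedDifference P ℱ B ε q) {k : ℕ}
    {X : Ω → ℝ} (hX : StronglyMeasurable[ℱ k] X) (hXb : ∀ ω, |X ω| ≤ 1) (r s : ℝ) :
    ∫ ω, (r * X ω + s * ε k ω) ^ 2 ∂P =
      r ^ 2 * ∫ ω, X ω ^ 2 ∂P + s ^ 2 * ∫ ω, q k ω ∂P := by
  have hXm := (hX.mono (ℱ.le k)).aestronglyMeasurable (μ := P)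
  have i1 : Integrable (fun ω => X ω * ε k ω) P := (hε.integrable k).bdd_mul hXm (ae_of_all _ hXb)
  have i2 : Integrable (fun ω => X ω ^ 2) P :=
    Integrable.of_bound (hXm.pow 2) 1 (ae_of_all _ fun ω => by
      rw [Real.norm_eq_abs, abs_pow]; exact pow_le_one₀ (abs_nonneg _) (hXb ω))
  have e : ∀ ω, (r * X ω + s * ε k ω) ^ 2 =
      r ^ 2 * X ω ^ 2 + (2 * r * s) * (X ω * ε k ω) + s ^ 2 * ε k ω ^ 2 := fun ω => by ring
  simp_rw [e]
  have i3 : Integrable (fun ω => r ^ 2 * X ω ^ 2 + (2 * r * s) * (X ω * ε k ω)) P :=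
    (i2.const_mul _).add (i1.const_mul _)
  rw [integral_add i3 ((hε.integrable_sq k).const_mul _),
    integral_add (i2.const_mul _) (i1.const_mul _), integral_const_mul, integral_const_mul,
    integral_const_mul, hε.integral_mul_eq_zero hX hXb, hε.integral_sq]
  ring

theorem tendsto_integral_abs_of_sq {D : ℕ → Ω → ℝ} (hD : ∀ t, Measurable (D t))
    (hDb : ∀ t ω, |D t ω| ≤ 1)
    (h : Tendsto (fun t => ∫ ω, D t ω ^ 2 ∂P) atTop (𝓝 0)) :
    Tendsto (fun t => ∫ ω, |D t ω| ∂P) atTop (𝓝 0) := by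
  rw [Metric.tendsto_nhds]
  intro δ hδ
  filter_upwards [h.eventually_lt_const (show (0 : ℝ) < δ ^ 2 / 2 / 2 by positivity)] with t ht
  have i1 : Integrable (fun ω => |D t ω|) P :=
    (Integrable.of_bound (hD t).aestronglyMeasurable 1 (ae_of_all _ (hDb t))).abs
  have i2 : Integrable (fun ω => D t ω ^ 2) P :=
    Integrable.of_bound ((hD t).pow_const 2).aestronglyMeasurable 1 (ae_of_all _ fun ω => by
      rw [Real.norm_eq_abs, abs_pow]; exact pow_le_one₀ (abs_nonneg _) (hDb t ω))
  have hb : ∫ ω, |D t ω| ∂P ≤ ∫ ω, (δ / 4 + D t ω ^ 2 / δ) ∂P := by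
    refine integral_mono i1 ((integrable_const _).add (i2.div_const _)) fun ω => ?_
    -- Completing the square plays the role of the Cauchy–Schwarz inequality.
    have h1 : δ / 4 + D t ω ^ 2 / δ - |D t ω| = (δ / 2 - |D t ω|) ^ 2 / δ := by
      rw [← sq_abs (D t ω)]
      field_simp
      ring
    have h2 : 0 ≤ (δ / 2 - |D t ω|) ^ 2 / δ := by positivity
    simp only
    linarith
  rw [integral_add (integrable_const _) (i2.div_const _), integral_const, integral_div,
    probReal_univ, one_smul] at hb
  rw [Real.dist_eq, sub_zero, abs_of_nonneg (integral_nonneg fun ω => abs_nonneg _)]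
  have h3 : (∫ ω, D t ω ^ 2 ∂P) / δ < δ / 2 := by
    rw [div_lt_iff₀ hδ]
    nlinarith
  linarith

end Moments

/-! ### Limits of the urn system -/

section Limits

variable {Ω : Type*} {N a b : ℕ} {α : ℝ} {red : ℕ → Fin N → Set Ω}

theorem abs_diff_le_one (hN : 1 < N) (t : ℕ) (j : Fin N) (ω : Ω) :
    |urnFraction a b red t j ω - totalFraction a b red t ω| ≤ 1 := by
  have h1 := urnFraction_nonneg (a := a) (b := b) (red := red) t j ω
  have h2 := urnFraction_le_one (a := a) (b := b) (red := red) t j ω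
  have h3 := totalFraction_nonneg (a := a) (b := b) (red := red) t ω
  have h4 := totalFraction_le_one (a := a) (b := b) (red := red) hN t ω
  rw [abs_le]
  constructor <;> linarith

/-- Concavity of `p (1 - p)`, in the form of Cauchy–Schwarz, even gives an extra factor `1/N`, which
is discarded. -/
theorem noiseVar_mean_le (hN : 1 < N) (t : ℕ) (ω : Ω) :
    noiseVar a b α red (fun _ => 1 / (N : ℝ)) t ω ≤
      totalFraction a b red t ω - totalFraction a b red t ω ^ 2 := by
  have h1 : (1 : ℝ) ≤ N := by exact_mod_cast hN.le
  have h0 : (N : ℝ) ≠ 0 := by positivity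
  have hs := sum_redProb (a := a) (b := b) (α := α) (red := red) hN t ω
  have hcs := sq_sum_le_card_mul_sum_sq (s := (Finset.univ : Finset (Fin N)))
    (f := fun i => redProb a b α red t i ω)
  rw [hs, Finset.card_univ, Fintype.card_fin] at hcs
  have hT0 := totalFraction_nonneg (a := a) (b := b) (red := red) t ω
  have hT1 := totalFraction_le_one (a := a) (b := b) (red := red) hN t ω
  set T := totalFraction a b red t ω
  set S := ∑ i, redProb a b α red t i ω ^ 2
  have e : noiseVar a b α red (fun _ => 1 / (N : ℝ)) t ω = (1 / (N : ℝ)) ^ 2 * (N * T - S) := by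
    rw [noiseVar, ← Finset.mul_sum, ← hs, ← Finset.sum_sub_distrib]
    congr 1
    exact Finset.sum_congr rfl fun i _ => by ring
  have hS : N * T ^ 2 ≤ S := by
    have : (N : ℝ) * (N * T ^ 2) ≤ N * S := by linarith
    exact le_of_mul_le_mul_left this (by linarith)
  rw [e, div_pow, one_pow, div_mul_eq_mul_div, one_mul, div_le_iff₀ (by positivity)]
  have h3 : 0 ≤ T - T ^ 2 := by nlinarith
  nlinarith [mul_nonneg (mul_nonneg (by linarith : (0 : ℝ) ≤ N) (by linarith : (0 : ℝ) ≤ N - 1)) h3]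

variable [m0 : MeasurableSpace Ω] {P : Measure Ω} {Z : Ω → ℝ}

theorem measurable_totalFraction_of_isUrnSystem (hred : IsUrnSystem P a b α red) (t : ℕ) :
    Measurable (totalFraction a b red t) :=
  (measurable_totalFraction t).mono ((historyFiltration hred).le t) le_rfl

theorem ae_mem_Icc_of_tendsto (hN : 1 < N)
    (hZ : ∀ᵐ ω ∂P, Tendsto (fun t => totalFraction a b red t ω) atTop (𝓝 (Z ω))) :
    ∀ᵐ ω ∂P, 0 ≤ Z ω ∧ Z ω ≤ 1 := by
  filter_upwards [hZ] with ω hω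
  exact ⟨ge_of_tendsto' hω fun t => totalFraction_nonneg t ω,
    le_of_tendsto' hω fun t => totalFraction_le_one hN t ω⟩

/-- A Gaussian law of positive variance has no atoms. -/
theorem ae_nonpos_of_isDegenerate {V : Ω → ℝ} (hV : Measurable V)
    (h : IsDegenerate P (gaussianKernel V hV)) : ∀ᵐ ω ∂P, V ω ≤ 0 := by
  obtain ⟨Y, hY⟩ := h
  filter_upwards [hY] with ω hω
  by_contra hpos
  have hv : (V ω).toNNReal ≠ 0 := (Real.toNNReal_pos.2 (not_le.1 hpos)).ne'
  have := nullSingletonClass_gaussianReal (μ := 0) hv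
  have h1 : gaussianReal 0 (V ω).toNNReal = Measure.dirac (Y ω) := hω
  have h2 := measure_singleton (μ := gaussianReal 0 (V ω).toNNReal) (Y ω)
  rw [h1, Measure.dirac_apply_of_mem (Set.mem_singleton _)] at h2
  exact one_ne_zero h2

variable [IsProbabilityMeasure P]

/-- Noise and past are orthogonal, so the second moment is multiplied by `(1 - α/n)² ≤ 1 - α/n` and
gains at most `4/n²`, where 4 is the square of the bound on the ℓ¹ norm of `diffCoeff j`. -/
theorem tendsto_integral_diff_sq (hN : 1 < N) (ha : 1 ≤ a) (h₀ : 1 / 2 ≤ α) (h₁ : α ≤ 1)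
    (hred : IsUrnSystem P a b α red) (j : Fin N) :
    Tendsto (fun t => ∫ ω, (urnFraction a b red t j ω - totalFraction a b red t ω) ^ 2 ∂P) atTop
      (𝓝 0) := by
  have hε := isBoundedDifference_noise hN h₀ h₁ hred (sum_abs_diffCoeff_le hN j)
  refine tendsto_zero_of_harmonic_contraction (a + b) (β := α) (C := 4) (by linarith)
    (fun t => integral_nonneg fun ω => sq_nonneg _) (Eventually.of_forall fun t => ?_)
  have hn : (1 : ℝ) ≤ (a : ℝ) + b + t + 1 := by
    have : (0 : ℝ) ≤ (a : ℝ) + b + t := by positivity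
    linarith
  have hX : StronglyMeasurable[historyFiltration hred t]
      (fun ω => urnFraction a b red t j ω - totalFraction a b red t ω) :=
    ((measurable_urnFraction t j).sub (measurable_totalFraction t)).stronglyMeasurable
  have key := hε.integral_add_sq hX (abs_diff_le_one hN t j) (1 - α / ((a : ℝ) + b + t + 1))
    (1 / ((a : ℝ) + b + t + 1))
  have e : ∀ ω, urnFraction a b red (t + 1) j ω - totalFraction a b red (t + 1) ω =
      (1 - α / ((a : ℝ) + b + t + 1)) *
        (urnFraction a b red t j ω - totalFraction a b red t ω) +
      1 / ((a : ℝ) + b + t + 1) * noise a b α red (diffCoeff j) t ω := fun ω => by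
    rw [diff_succ (α := α) hN ha]; ring
  simp_rw [e]
  rw [key]
  push_cast
  have hq : ∫ ω, noiseVar a b α red (diffCoeff j) t ω ∂P ≤ 4 := by
    have := integral_mono (hε.integrable_var t) (integrable_const (μ := P) (2 ^ 2 : ℝ))
      fun ω => (hε.var_bound t ω).2
    rw [integral_const, probReal_univ, one_smul] at this
    linarith
  set n : ℝ := (a : ℝ) + b + t + 1
  set x := ∫ ω, (urnFraction a b red t j ω - totalFraction a b red t ω) ^ 2 ∂P with hx
  have hx0 : 0 ≤ x := integral_nonneg fun ω => sq_nonneg _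
  have hr0 : 0 ≤ 1 - α / n := by
    rw [sub_nonneg, div_le_one (by linarith)]; linarith
  have hr1 : 1 - α / n ≤ 1 := by
    have : 0 ≤ α / n := div_nonneg (by linarith) (by linarith)
    linarith
  refine add_le_add (mul_le_mul_of_nonneg_right ?_ hx0) ?_
  · nlinarith
  · rw [div_pow, one_pow, div_mul_eq_mul_div, one_mul]
    exact div_le_div_of_nonneg_right hq (by positivity)

theorem tendsto_integral_abs_diff (hN : 1 < N) (ha : 1 ≤ a) (h₀ : 1 / 2 ≤ α) (h₁ : α ≤ 1)
    (hred : IsUrnSystem P a b α red) (j : Fin N) :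
    Tendsto (fun t => ∫ ω, |urnFraction a b red t j ω - totalFraction a b red t ω| ∂P) atTop
      (𝓝 0) :=
  tendsto_integral_abs_of_sq (fun t => ((measurable_urnFraction t j).sub
    (measurable_totalFraction t)).mono ((historyFiltration hred).le t) le_rfl)
    (fun t ω => abs_diff_le_one hN t j ω) (tendsto_integral_diff_sq hN ha h₀ h₁ hred j)

theorem sum_abs_mean_le (hN : 1 < N) : ∑ _i : Fin N, |1 / (N : ℝ)| ≤ 1 := by
  have h0 : (N : ℝ) ≠ 0 := by positivity
  rw [abs_of_nonneg (by positivity), Finset.sum_const, Finset.card_univ, Fintype.card_fin,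
    nsmul_eq_mul, mul_one_div_cancel h0]

theorem integrable_totalFraction (hN : 1 < N) (hred : IsUrnSystem P a b α red) (t : ℕ) :
    Integrable (totalFraction a b red t) P :=
  Integrable.of_bound (measurable_totalFraction_of_isUrnSystem hred t).aestronglyMeasurable 1
    (ae_of_all _ fun ω => by
      rw [Real.norm_eq_abs, abs_of_nonneg (totalFraction_nonneg t ω)]
      exact totalFraction_le_one hN t ω)

/-- The total fraction of red balls is a martingale. -/
theorem martingale_totalFraction (hN : 1 < N) (ha : 1 ≤ a) (h₀ : 1 / 2 ≤ α) (h₁ : α ≤ 1)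
    (hred : IsUrnSystem P a b α red) :
    Martingale (totalFraction a b red) (historyFiltration hred) P := by
  have hε := isBoundedDifference_noise hN h₀ h₁ hred (sum_abs_mean_le hN)
  refine martingale_nat (fun t => (measurable_totalFraction t).stronglyMeasurable)
    (integrable_totalFraction hN hred) fun t => ?_
  have e : totalFraction a b red (t + 1) = totalFraction a b red t +
      (1 / ((a : ℝ) + b + t + 1)) • noise a b α red (fun _ => 1 / (N : ℝ)) t := by
    ext ω
    rw [totalFraction_succ (α := α) hN ha, Pi.add_apply, Pi.smul_apply, smul_eq_mul]
    ring
  have h1 := condExp_add (integrable_totalFraction hN hred t)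
    ((hε.integrable t).smul (1 / ((a : ℝ) + b + t + 1))) (historyFiltration hred t)
  rw [condExp_of_stronglyMeasurable ((historyFiltration hred).le t)
    (measurable_totalFraction t).stronglyMeasurable (integrable_totalFraction hN hred t)] at h1
  rw [e]
  filter_upwards [h1, condExp_smul (μ := P) (1 / ((a : ℝ) + b + t + 1))
    (noise a b α red (fun _ => 1 / (N : ℝ)) t) (historyFiltration hred t),
    hε.condExp_eq_zero t] with ω e1 e2 e3
  rw [e1, Pi.add_apply, e2, Pi.smul_apply, e3]
  simp

theorem exists_limit_totalFraction (hN : 1 < N) (ha : 1 ≤ a) (h₀ : 1 / 2 ≤ α) (h₁ : α ≤ 1)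
    (hred : IsUrnSystem P a b α red) :
    ∃ Z : Ω → ℝ, Measurable Z ∧ ∀ᵐ ω ∂P,
      Tendsto (fun t => totalFraction a b red t ω) atTop (𝓝 (Z ω)) := by
  have hM := martingale_totalFraction hN ha h₀ h₁ hred
  refine measurable_limit_of_tendsto_metrizable_ae
    (fun t => (measurable_totalFraction_of_isUrnSystem hred t).aemeasurable)
    (hM.submartingale.exists_ae_tendsto_of_bdd (R := 1) fun t => ?_)
  refine (eLpNorm_le_of_ae_bound (C := 1) (ae_of_all _ fun ω => ?_)).trans ?_
  · rw [Real.norm_eq_abs, abs_of_nonneg (totalFraction_nonneg t ω)]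
    exact totalFraction_le_one hN t ω
  · simp

theorem tendsto_integral_abs_totalFraction_sub (hN : 1 < N) (hred : IsUrnSystem P a b α red)
    (hZm : Measurable Z)
    (hZ : ∀ᵐ ω ∂P, Tendsto (fun t => totalFraction a b red t ω) atTop (𝓝 (Z ω))) :
    Tendsto (fun t => ∫ ω, |totalFraction a b red t ω - Z ω| ∂P) atTop (𝓝 0) := by
  have := tendsto_integral_of_dominated_convergence (μ := P) (f := fun _ => (0 : ℝ))
    (F := fun t ω => |totalFraction a b red t ω - Z ω|) (fun _ => 1)
    (fun t => (((measurable_totalFraction_of_isUrnSystem hred t).sub hZm).abs).aestronglyMeasurable)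
    (integrable_const _) (fun t => ?_) ?_
  · simpa using this
  · filter_upwards [ae_mem_Icc_of_tendsto hN hZ] with ω hω
    have h3 := totalFraction_nonneg (a := a) (b := b) (red := red) t ω
    have h4 := totalFraction_le_one (a := a) (b := b) (red := red) hN t ω
    rw [Real.norm_eq_abs, abs_abs, abs_le]
    constructor <;> linarith [hω.1, hω.2]
  · filter_upwards [hZ] with ω hω
    simpa using (hω.sub_const (Z ω)).abs

/-- The conditional variances of the noise driving the difference of urn `j` and the mean of the
urns converge in `L¹`. -/
theorem tendsto_integral_abs_noiseVar_sub (hN : 1 < N) (ha : 1 ≤ a) (h₀ : 1 / 2 ≤ α) (h₁ : α ≤ 1)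
    (hred : IsUrnSystem P a b α red) (j : Fin N) (hZm : Measurable Z)
    (hZ : ∀ᵐ ω ∂P, Tendsto (fun t => totalFraction a b red t ω) atTop (𝓝 (Z ω))) :
    Tendsto (fun t => ∫ ω, |noiseVar a b α red (diffCoeff j) t ω -
      (1 - 1 / (N : ℝ)) * (Z ω - Z ω ^ 2)| ∂P) atTop (𝓝 0) := by
  have hZb := ae_mem_Icc_of_tendsto hN hZ
  have hlim : Tendsto (fun t => ∑ i : Fin N, ((∫ ω, |totalFraction a b red t ω - Z ω| ∂P) +
      ∫ ω, |urnFraction a b red t i ω - totalFraction a b red t ω| ∂P)) atTop (𝓝 0) := by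
    have := tendsto_finsetSum (Finset.univ : Finset (Fin N)) fun i _ =>
      (tendsto_integral_abs_totalFraction_sub hN hred hZm hZ).add
        (tendsto_integral_abs_diff hN ha h₀ h₁ hred i)
    simpa using this
  refine squeeze_zero (fun t => integral_nonneg fun ω => abs_nonneg _) (fun t => ?_) hlim
  have hZi : Integrable Z P := Integrable.of_bound hZm.aestronglyMeasurable 1 (by
    filter_upwards [hZb] with ω hω
    rw [Real.norm_eq_abs, abs_of_nonneg hω.1]
    exact hω.2)
  have hUi : ∀ i, Integrable (urnFraction a b red t i) P := fun i =>
    Integrable.of_bound ((measurable_urnFraction t i).mono ((historyFiltration hred).le t)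
      le_rfl).aestronglyMeasurable 1 (ae_of_all _ fun ω => by
      rw [Real.norm_eq_abs, abs_of_nonneg (urnFraction_nonneg t i ω)]
      exact urnFraction_le_one t i ω)
  have i1 : Integrable (fun ω => |totalFraction a b red t ω - Z ω|) P :=
    ((integrable_totalFraction hN hred t).sub hZi).abs
  have i2 : ∀ i, Integrable (fun ω => |urnFraction a b red t i ω - totalFraction a b red t ω|) P :=
    fun i => ((hUi i).sub (integrable_totalFraction hN hred t)).abs
  have e : ∑ i : Fin N, ((∫ ω, |totalFraction a b red t ω - Z ω| ∂P) +
      ∫ ω, |urnFraction a b red t i ω - totalFraction a b red t ω| ∂P) =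
      ∫ ω, ∑ i : Fin N, (|totalFraction a b red t ω - Z ω| +
        |urnFraction a b red t i ω - totalFraction a b red t ω|) ∂P := by
    have i3 : ∀ i, Integrable (fun ω => |totalFraction a b red t ω - Z ω| +
        |urnFraction a b red t i ω - totalFraction a b red t ω|) P := fun i => i1.add (i2 i)
    rw [integral_finsetSum _ fun i _ => i3 i]
    exact Finset.sum_congr rfl fun i _ => (integral_add i1 (i2 i)).symm
  rw [e]
  refine integral_mono_of_nonneg (ae_of_all _ fun ω => abs_nonneg _)
    (integrable_finsetSum _ fun i _ => i1.add (i2 i)) ?_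
  filter_upwards [hZb] with ω hω
  rw [← sum_diffCoeff_sq hN j, Finset.sum_mul, noiseVar, ← Finset.sum_sub_distrib]
  refine (Finset.abs_sum_le_sum_abs _ _).trans (Finset.sum_le_sum fun i _ => ?_)
  have hp := redProb_nonneg (a := a) (b := b) (red := red) h₀ h₁ t i ω
  have hp' := redProb_le_one (a := a) (b := b) (red := red) hN h₀ h₁ t i ω
  set p := redProb a b α red t i ω with hpdef
  -- This factorisation shows that `p (1 - p)` is 1-Lipschitz on the unit interval.
  have e2 : diffCoeff j i ^ 2 * (p * (1 - p)) - diffCoeff j i ^ 2 * (Z ω - Z ω ^ 2) =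
      diffCoeff j i ^ 2 * ((1 - p - Z ω) * (p - Z ω)) := by ring
  have hc : diffCoeff j i ^ 2 ≤ 1 := by
    have h1 : (1 : ℝ) ≤ N := by exact_mod_cast hN.le
    have h2 : 0 ≤ 1 / (N : ℝ) := by positivity
    have h3 : 1 / (N : ℝ) ≤ 1 := (div_le_one (by linarith)).2 h1
    rw [diffCoeff]
    split_ifs <;> nlinarith
  have hd : |1 - p - Z ω| ≤ 1 := by
    rw [abs_le]
    constructor <;> linarith [hω.1, hω.2]
  have hpz : |p - Z ω| ≤ |totalFraction a b red t ω - Z ω| +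
      |urnFraction a b red t i ω - totalFraction a b red t ω| := by
    have e3 : p - Z ω = (totalFraction a b red t ω - Z ω) +
        (1 - α) * (urnFraction a b red t i ω - totalFraction a b red t ω) := by
      rw [hpdef, redProb]; ring
    rw [e3]
    refine (abs_add_le _ _).trans (add_le_add le_rfl ?_)
    rw [abs_mul, abs_of_nonneg (by linarith)]
    exact mul_le_of_le_one_left (abs_nonneg _) (by linarith)
  rw [e2, abs_mul, abs_mul, abs_of_nonneg (sq_nonneg _)]
  have h5 : |1 - p - Z ω| * |p - Z ω| ≤ |p - Z ω| := mul_le_of_le_one_left (abs_nonneg _) hd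
  have h6 : diffCoeff j i ^ 2 * (|1 - p - Z ω| * |p - Z ω|) ≤ |1 - p - Z ω| * |p - Z ω| :=
    mul_le_of_le_one_left (by positivity) hc
  linarith

/-! ### Nondegeneracy -/

/-- One step multiplies the integral by at least `1 - 1/n²`, and `(1 - 1/n²) · n/(n - 1) = (n +
1)/n` makes the bound reproduce itself. The constant gives equality at time 0. -/
theorem integral_variance_lower_bound (hN : 1 < N) (ha : 1 ≤ a) (hb : 1 ≤ b) (h₀ : 1 / 2 ≤ α)
    (h₁ : α ≤ 1) (hred : IsUrnSystem P a b α red) (t : ℕ) :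
    (a : ℝ) * b / ((a : ℝ) + b) ^ 2 * (((a : ℝ) + b) / ((a : ℝ) + b + 1)) *
        (((a : ℝ) + b + t + 1) / ((a : ℝ) + b + t)) ≤
      ∫ ω, (totalFraction a b red t ω - totalFraction a b red t ω ^ 2) ∂P := by
  have ha' : (0 : ℝ) < a := by exact_mod_cast ha
  have hb' : (0 : ℝ) < b := by exact_mod_cast hb
  induction t with
  | zero =>
    simp only [totalFraction_zero hN, integral_const, probReal_univ, one_smul, Nat.cast_zero,
      add_zero]
    refine le_of_eq ?_
    field_simp
    ring
  | succ t ih =>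
    have hε := isBoundedDifference_noise hN h₀ h₁ hred (sum_abs_mean_le hN)
    have hTm : StronglyMeasurable[historyFiltration hred t] (totalFraction a b red t) :=
      (measurable_totalFraction t).stronglyMeasurable
    have hTb : ∀ t ω, |totalFraction a b red t ω| ≤ 1 := fun t ω => by
      rw [abs_of_nonneg (totalFraction_nonneg t ω)]; exact totalFraction_le_one hN t ω
    have hTi := integrable_totalFraction hN hred
    have hTi2 : ∀ t, Integrable (fun ω => totalFraction a b red t ω ^ 2) P := fun t =>
      Integrable.of_bound ((measurable_totalFraction_of_isUrnSystem hred t).pow_const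
        2).aestronglyMeasurable 1
        (ae_of_all _ fun ω => by
          rw [Real.norm_eq_abs, abs_pow]; exact pow_le_one₀ (abs_nonneg _) (hTb t ω))
    have key := hε.integral_add_sq hTm (hTb t) 1 (1 / ((a : ℝ) + b + t + 1))
    have e : ∀ ω, totalFraction a b red (t + 1) ω ^ 2 = (1 * totalFraction a b red t ω +
        1 / ((a : ℝ) + b + t + 1) * noise a b α red (fun _ => 1 / (N : ℝ)) t ω) ^ 2 := fun ω => by
      rw [totalFraction_succ (α := α) hN ha]; ring
    have hmean : ∫ ω, totalFraction a b red (t + 1) ω ∂P = ∫ ω, totalFraction a b red t ω ∂P := by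
      have := (martingale_totalFraction hN ha h₀ h₁ hred).setIntegral_eq (Nat.le_succ t)
        (MeasurableSet.univ)
      simpa using this.symm
    rw [integral_sub (hTi _) (hTi2 _), hmean]
    simp_rw [e]
    rw [key]
    have hv := integral_mono (hε.integrable_var t) ((hTi t).sub (hTi2 t))
      fun ω => noiseVar_mean_le hN t ω
    have hsub := integral_sub (hTi t) (hTi2 t)
    simp only [Pi.sub_apply] at hv
    rw [hsub] at hv ih
    set x := ∫ ω, totalFraction a b red t ω ∂P
    set y := ∫ ω, totalFraction a b red t ω ^ 2 ∂P
    set v := ∫ ω, noiseVar a b α red (fun _ => 1 / (N : ℝ)) t ω ∂P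
    set κ := (a : ℝ) * b / ((a : ℝ) + b) ^ 2 * (((a : ℝ) + b) / ((a : ℝ) + b + 1))
    push_cast
    rw [← add_assoc]
    have hn : 1 < (a : ℝ) + b + t + 1 := by
      have : (0 : ℝ) < (a : ℝ) + b + t := by positivity
      linarith
    have hnt : (a : ℝ) + b + t = (a : ℝ) + b + t + 1 - 1 := by ring
    rw [hnt, sub_add_cancel] at ih
    set n : ℝ := (a : ℝ) + b + t + 1
    have hr : 0 ≤ 1 - 1 / n ^ 2 := by
      rw [sub_nonneg, div_le_one (by positivity)]
      nlinarith
    have h4 : κ * ((n + 1) / n) ≤ (1 - 1 / n ^ 2) * (x - y) := by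
      refine le_trans (le_of_eq ?_) (mul_le_mul_of_nonneg_left ih hr)
      have : n - 1 ≠ 0 := by linarith
      field_simp
      ring
    have h5 : 1 / n ^ 2 * v ≤ 1 / n ^ 2 * (x - y) := mul_le_mul_of_nonneg_left hv (by positivity)
    refine h4.trans ?_
    rw [div_pow, one_pow, one_mul]
    linarith

theorem integral_limit_variance_pos (hN : 1 < N) (ha : 1 ≤ a) (hb : 1 ≤ b) (h₀ : 1 / 2 ≤ α)
    (h₁ : α ≤ 1) (hred : IsUrnSystem P a b α red)
    (hZ : ∀ᵐ ω ∂P, Tendsto (fun t => totalFraction a b red t ω) atTop (𝓝 (Z ω))) :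
    0 < ∫ ω, (Z ω - Z ω ^ 2) ∂P := by
  have ha' : (0 : ℝ) < a := by exact_mod_cast ha
  have hb' : (0 : ℝ) < b := by exact_mod_cast hb
  have hlim := tendsto_integral_of_dominated_convergence (μ := P) (f := fun ω => Z ω - Z ω ^ 2)
    (F := fun t ω => totalFraction a b red t ω - totalFraction a b red t ω ^ 2) (fun _ => 1)
    (fun t => ((measurable_totalFraction_of_isUrnSystem hred t).sub
      ((measurable_totalFraction_of_isUrnSystem hred t).pow_const 2)).aestronglyMeasurable)
    (integrable_const _) (fun t => ae_of_all _ fun ω => ?_) ?_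
  · refine lt_of_lt_of_le
      (show 0 < (a : ℝ) * b / ((a : ℝ) + b) ^ 2 * (((a : ℝ) + b) / ((a : ℝ) + b + 1)) by positivity)
      (ge_of_tendsto' hlim fun t => ?_)
    refine le_trans ?_ (integral_variance_lower_bound hN ha hb h₀ h₁ hred t)
    refine le_mul_of_one_le_right (by positivity) ?_
    rw [le_div_iff₀ (by positivity)]
    linarith
  · have h3 := totalFraction_nonneg (a := a) (b := b) (red := red) t ω
    have h4 := totalFraction_le_one (a := a) (b := b) (red := red) hN t ω
    rw [Real.norm_eq_abs, abs_le]
    constructor <;> nlinarith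
  · filter_upwards [hZ] with ω hω
    exact hω.sub (hω.pow 2)

theorem not_isDegenerate (hN : 1 < N) (ha : 1 ≤ a) (hb : 1 ≤ b) (h₀ : 1 / 2 ≤ α) (h₁ : α ≤ 1)
    (hred : IsUrnSystem P a b α red)
    (hZ : ∀ᵐ ω ∂P, Tendsto (fun t => totalFraction a b red t ω) atTop (𝓝 (Z ω)))
    {κ : ℝ} (hκ : 0 < κ) (hV : Measurable fun ω => κ * (Z ω - Z ω ^ 2)) :
    ¬ IsDegenerate P (gaussianKernel (fun ω => κ * (Z ω - Z ω ^ 2)) hV) := by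
  intro h
  have h1 := ae_nonpos_of_isDegenerate hV h
  have h2 : ∫ ω, (Z ω - Z ω ^ 2) ∂P ≤ 0 := integral_nonpos_of_ae (by
    filter_upwards [h1] with ω hω
    exact nonpos_of_mul_nonpos_right hω hκ)
  exact absurd h2 (not_le.2 (integral_limit_variance_pos hN ha hb h₀ h₁ hred hZ))

/-! ### Stable convergence of the scaled differences -/

/-- The common form of both regimes, which differ only in the scaling `r` and in the limit `c` of
the scaled sum of squared weights. -/
theorem convergesStably_scaled_diff (hN : 1 < N) (ha : 1 ≤ a) (h₀ : 1 / 2 ≤ α) (h₁ : α ≤ 1)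
    (hred : IsUrnSystem P a b α red) (j : Fin N) (hZm : Measurable Z)
    (hZ : ∀ᵐ ω ∂P, Tendsto (fun t => totalFraction a b red t ω) atTop (𝓝 (Z ω)))
    {r : ℕ → ℝ} {c κ : ℝ} (hr : ∀ᶠ t : ℕ in atTop, r t ^ 2 ≤ t)
    (hsum : Tendsto (fun t => r t ^ 2 * weightSum (a + b) α t) atTop (𝓝 c))
    (hfix : ∀ k, Tendsto (fun t => r t ^ 2 * contraction (a + b) α k t ^ 2) atTop (𝓝 0))
    (hκ : κ = c * (1 - 1 / (N : ℝ))) (hV : Measurable fun ω => κ * (Z ω - Z ω ^ 2)) :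
    ConvergesStably P
      (fun t ω => r t * (urnFraction a b red t j ω - totalFraction a b red t ω))
      (gaussianKernel (fun ω => κ * (Z ω - Z ω ^ 2)) hV) := by
  have hε := isBoundedDifference_noise hN h₀ h₁ hred (sum_abs_diffCoeff_le hN j)
  have hZb := ae_mem_Icc_of_tendsto hN hZ
  have hN1 : 0 ≤ 1 - 1 / (N : ℝ) := by
    have h1 : (1 : ℝ) ≤ N := by exact_mod_cast hN.le
    rw [sub_nonneg, div_le_one (by linarith)]
    exact h1
  set w : ℕ → ℕ → ℝ := fun t k =>
    r t * (contraction (a + b) α (k + 1) t / (((a + b : ℕ) : ℝ) + k + 1)) with hw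
  have hsum' : Tendsto (fun t => ∑ k ∈ Finset.range t, w t k ^ 2) atTop (𝓝 c) := by
    refine hsum.congr fun t => ?_
    rw [weightSum, Finset.mul_sum]
    exact Finset.sum_congr rfl fun k _ => by rw [hw]; ring
  have hfix' : ∀ k, Tendsto (fun t => w t k) atTop (𝓝 0) := by
    intro k
    have h1 := ((hfix (k + 1)).div_const ((((a + b : ℕ) : ℝ) + k + 1) ^ 2)).sqrt
    rw [zero_div, Real.sqrt_zero] at h1
    rw [tendsto_zero_iff_abs_tendsto_zero]
    refine h1.congr fun t => ?_
    rw [Function.comp_apply, ← Real.sqrt_sq_eq_abs]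
    congr 1
    rw [hw, mul_pow, div_pow, mul_div_assoc]
  have hsmall : ∀ η : ℝ, 0 < η → ∀ᶠ s in atTop, ∀ᶠ t in atTop, ∀ k, s ≤ k → k < t →
      |w t k| ≤ η := by
    intro η hη
    have h1 := (tendsto_natCast_add_atTop (a + b)).const_div_atTop (2 : ℝ)
    filter_upwards [h1.eventually_le_const (show 0 < η ^ 2 by positivity)] with s hs
    filter_upwards [hr] with t ht k hsk hkt
    refine abs_le_of_sq_le_sq (le_trans ?_ hs) hη.le
    have hsk' : (s : ℝ) ≤ k := by exact_mod_cast hsk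
    have hc := contraction_sq_le (m := a + b) h₀ h₁ (Nat.succ_le_of_lt hkt)
    have hm0 : (0 : ℝ) ≤ ((a + b : ℕ) : ℝ) := Nat.cast_nonneg _
    set m : ℝ := ((a + b : ℕ) : ℝ)
    have hk0 : (0 : ℝ) ≤ k := Nat.cast_nonneg _
    have hs0 : (0 : ℝ) ≤ s := Nat.cast_nonneg _
    have ht0 : (0 : ℝ) ≤ t := Nat.cast_nonneg _
    -- From `r t ^ 2 ≤ t` and `contraction_sq_le`; the squared weight is then at most `2/(m + k +
    -- 1)`, uniformly in `t`.
    have h2 : r t ^ 2 * contraction (a + b) α (k + 1) t ^ 2 ≤ m + k + 2 := by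
      refine (mul_le_mul ht hc (sq_nonneg _) ht0).trans ?_
      push_cast
      rw [mul_div_assoc', div_le_iff₀ (by positivity)]
      nlinarith
    have e : w t k ^ 2 =
        r t ^ 2 * contraction (a + b) α (k + 1) t ^ 2 / (m + k + 1) ^ 2 := by
      rw [hw, mul_pow, div_pow, mul_div_assoc]
    rw [e]
    calc r t ^ 2 * contraction (a + b) α (k + 1) t ^ 2 / (m + k + 1) ^ 2
        ≤ (m + k + 2) / (m + k + 1) ^ 2 := div_le_div_of_nonneg_right h2 (by positivity)
      _ ≤ 2 / (m + k + 1) := by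
          rw [div_le_div_iff₀ (by positivity) (by positivity)]
          nlinarith [mul_nonneg (add_nonneg hm0 hk0) (by positivity : 0 ≤ m + k + 1)]
      _ ≤ 2 / (m + s + 1) := by gcongr
  have hV₀ : Integrable (fun ω => (1 - 1 / (N : ℝ)) * (Z ω - Z ω ^ 2)) P := by
    refine Integrable.const_mul (Integrable.of_bound
      (hZm.sub (hZm.pow_const 2)).aestronglyMeasurable 1 ?_) _
    filter_upwards [hZb] with ω hω
    rw [Real.norm_eq_abs, abs_le, Pi.sub_apply]
    constructor <;> nlinarith [hω.1, hω.2]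
  have key := hε.convergesStably hsum' hfix' hsmall hV₀ (by
      filter_upwards [hZb] with ω hω
      exact mul_nonneg hN1 (by nlinarith [hω.1, hω.2]))
    (tendsto_integral_abs_noiseVar_sub hN ha h₀ h₁ hred j hZm hZ) hV
    (ae_of_all _ fun ω => by rw [hκ]; ring)
  have e : (fun t ω => r t * (urnFraction a b red t j ω - totalFraction a b red t ω)) =
      fun t ω => ∑ k ∈ Finset.range t, w t k * noise a b α red (diffCoeff j) k ω := by
    ext t ω
    rw [diff_eq_sum (α := α) hN ha, Finset.mul_sum]
    exact Finset.sum_congr rfl fun k _ => by rw [hw]; ring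
  rw [e]
  exact key

end Limits

/-! ### The two regimes -/

section Regimes

theorem tendsto_mul_contraction_sq_of_half_lt (m : ℕ) {α : ℝ} (h₀ : 1 / 2 < α) (k : ℕ) :
    Tendsto (fun t : ℕ => √(t : ℝ) ^ 2 * contraction m α k t ^ 2) atTop (𝓝 0) := by
  refine squeeze_zero (fun t => by positivity) (fun t => ?_) (tendsto_mul_contraction_sq m h₀ k)
  rw [Real.sq_sqrt (Nat.cast_nonneg t)]
  refine mul_le_mul_of_nonneg_right ?_ (sq_nonneg _)
  have : (0 : ℝ) ≤ m := Nat.cast_nonneg m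
  linarith

/-- At `t = 0` and `t = 1` both sides are 0, because division by zero gives 0. -/
theorem sqrt_div_sqrt_log_sq (t : ℕ) :
    (√(t : ℝ) / √(Real.log (t : ℝ))) ^ 2 = (t : ℝ) / Real.log t := by
  rw [div_pow, Real.sq_sqrt (Nat.cast_nonneg t), Real.sq_sqrt (Real.log_natCast_nonneg t)]

theorem tendsto_log_natCast_atTop : Tendsto (fun t : ℕ => Real.log (t : ℝ)) atTop atTop :=
  Real.tendsto_log_atTop.comp tendsto_natCast_atTop_atTop

/-- At `α = 1/2`, `t` times the squared contraction stays bounded, so the convergence to 0 is due to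
the logarithm alone. -/
theorem tendsto_div_log_mul_contraction_sq (m k : ℕ) :
    Tendsto (fun t : ℕ => (√(t : ℝ) / √(Real.log (t : ℝ))) ^ 2 * contraction m (1 / 2) k t ^ 2)
      atTop (𝓝 0) := by
  refine squeeze_zero' (Eventually.of_forall fun t => by positivity) ?_
    (tendsto_log_natCast_atTop.const_div_atTop ((m : ℝ) + k + 1))
  filter_upwards [eventually_ge_atTop k, tendsto_log_natCast_atTop.eventually_gt_atTop 0]
    with t ht hlog
  rw [sqrt_div_sqrt_log_sq, div_mul_eq_mul_div]
  refine div_le_div_of_nonneg_right ?_ hlog.le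
  have h1 := contraction_sq_le (m := m) (α := 1 / 2) le_rfl (by norm_num) ht
  have ht0 : (0 : ℝ) ≤ t := Nat.cast_nonneg t
  refine (mul_le_mul_of_nonneg_left h1 ht0).trans ?_
  rw [mul_div_assoc', div_le_iff₀ (by positivity), mul_comm]
  refine mul_le_mul_of_nonneg_left ?_ (by positivity)
  have : (0 : ℝ) ≤ m := Nat.cast_nonneg m
  linarith

end Regimes

end InteractingUrns

end

theorem theorem3 {Ω : Type*} [MeasurableSpace Ω] (P : Measure Ω) [IsProbabilityMeasure P]
    (N a b : ℕ) (hN : 1 < N) (ha : 1 ≤ a) (hb : 1 ≤ b)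
    (α : ℝ) (hα₀ : 1 / 2 ≤ α) (hα₁ : α ≤ 1)
    (red : ℕ → Fin N → Set Ω) (hred : InteractingUrns.IsUrnSystem P a b α red) (j : Fin N) :
    (∃ Z : Ω → ℝ, Measurable Z ∧ ∀ᵐ ω ∂P,
      Tendsto (fun t => InteractingUrns.totalFraction a b red t ω) atTop (𝓝 (Z ω))) ∧
    ∀ (Z : Ω → ℝ) (hZ : Measurable Z),
      (∀ᵐ ω ∂P,
        Tendsto (fun t => InteractingUrns.totalFraction a b red t ω) atTop (𝓝 (Z ω))) →
      (1 / 2 < α →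
        InteractingUrns.ConvergesStably P
          (fun t ω => √(t : ℝ) *
            (InteractingUrns.urnFraction a b red t j ω - InteractingUrns.totalFraction a b red t ω))
          (InteractingUrns.gaussianKernel
            (fun ω => (1 - 1 / (N : ℝ)) / (2 * α - 1) * (Z ω - Z ω ^ 2))
            ((hZ.sub (hZ.pow_const 2)).const_mul _)) ∧
        ¬ InteractingUrns.IsDegenerate P
          (InteractingUrns.gaussianKernel
            (fun ω => (1 - 1 / (N : ℝ)) / (2 * α - 1) * (Z ω - Z ω ^ 2))
            ((hZ.sub (hZ.pow_const 2)).const_mul _))) ∧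
      (α = 1 / 2 →
        InteractingUrns.ConvergesStably P
          (fun t ω => √(t : ℝ) / √(Real.log (t : ℝ)) *
            (InteractingUrns.urnFraction a b red t j ω - InteractingUrns.totalFraction a b red t ω))
          (InteractingUrns.gaussianKernel
            (fun ω => (1 - 1 / (N : ℝ)) * (Z ω - Z ω ^ 2))
            ((hZ.sub (hZ.pow_const 2)).const_mul _)) ∧
        ¬ InteractingUrns.IsDegenerate P
          (InteractingUrns.gaussianKernel
            (fun ω => (1 - 1 / (N : ℝ)) * (Z ω - Z ω ^ 2))
            ((hZ.sub (hZ.pow_const 2)).const_mul _))) := by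
  have hN1 : 0 < 1 - 1 / (N : ℝ) := by
    have h1 : (1 : ℝ) < N := by exact_mod_cast hN
    rw [sub_pos, div_lt_one (by linarith)]
    exact h1
  refine ⟨InteractingUrns.exists_limit_totalFraction hN ha hα₀ hα₁ hred,
    fun Z hZ hlim => ⟨fun hα => ⟨?_, ?_⟩, fun hα => ⟨?_, ?_⟩⟩⟩
  · refine InteractingUrns.convergesStably_scaled_diff hN ha hα₀ hα₁ hred j hZ hlim
      (c := 1 / (2 * α - 1)) (Eventually.of_forall fun t => (Real.sq_sqrt (Nat.cast_nonneg t)).le)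
      ?_ (InteractingUrns.tendsto_mul_contraction_sq_of_half_lt _ hα) (by ring) _
    simp_rw [Real.sq_sqrt (Nat.cast_nonneg _)]
    exact InteractingUrns.tendsto_mul_weightSum (by lia) hα
  · exact InteractingUrns.not_isDegenerate hN ha hb hα₀ hα₁ hred hlim
      (div_pos hN1 (by linarith)) _
  · subst hα
    refine InteractingUrns.convergesStably_scaled_diff hN ha hα₀ hα₁ hred j hZ hlim
      (c := 1) ?_ ?_ (InteractingUrns.tendsto_div_log_mul_contraction_sq _) (by ring) _
    · filter_upwards [InteractingUrns.tendsto_log_natCast_atTop.eventually_ge_atTop 1] with t ht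
      rw [InteractingUrns.sqrt_div_sqrt_log_sq]
      exact div_le_self (Nat.cast_nonneg t) ht
    · simp_rw [InteractingUrns.sqrt_div_sqrt_log_sq]
      exact InteractingUrns.tendsto_div_log_mul_weightSum (by lia)
  · exact InteractingUrns.not_isDegenerate hN ha hb hα₀ hα₁ hred hlim hN1 _
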